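/- **Setting.** Let $\mathcal S,\mathcal A$ be finite non-empty sets, $P$ a transition kernel from $\mathcal S\times\mathcal A$ to $\mathcal S$, and $\mathcal C:\mathcal S\times\mathcal A\to[c_{\min},c_{\max}]$ a cost function with $c_{\min}>0$. Let $\beta\in(0,1)$ be a lower bound on all non-zero transition probabilities $P(s,a,s')$. Let $A_1,\dots,A_k\subseteq\mathcal S$ be pairwise disjoint, $g_1,\dots,g_k\in[0,c_{\max}]$, $\lambda\ge 0$, and write $G=\bigcup_iA_i$, $T=\mathcal S\setminus G$. Let $0<\epsilon_\varphi\le 1$, $\delta\in(0,1)$, and $$\bar V\ \ge\ \Big(\tfrac1{\beta^{|\mathcal S|}}\,\tfrac{1-\beta^{|\mathcal S|}}{1-\beta}+\lambda\Big)c_{\max},$$ and let $\epsilon_{\rm PT}>0$ be such that $\epsilon^{\mathcal L}:=\frac{c_{\min}\epsilon_{\rm PT}\epsilon_\varphi}{4\bar V}\le\frac{c_{\min}}2$. *Modified value.* For a stationary randomized policy $\pi$, $\tilde V_\pi$ is the value function of the capped Bellman evaluation operator $$x\mapsto\begin{cases}\min\big\{\sum_a\pi(a|s)\big(\mathcal C(s,a)+\sum_{s'}P(s,a,s')x(s')\big),\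 \bar V/\epsilon_\varphi\big\},&s\in T,\\ \lambda g_i,&s\in A_i,\end{cases}$$ i.e. the limit of its (increasing) iterates started from $\lambda g_i$ on $A_i$ and $0$ on $T$. A policy is cost-optimal if it minimizes $\tilde V$ from every state, and reach-optimal if it maximizes the probability of reaching $G$ from every state, among all stationary randomized policies. *Sampling.* For each $(s,a)$ let $X_{s,a,1},X_{s,a,2},\dots$ be i.i.d. samples from $P(s,a,\cdot)$, let $\hat P_n(s,a,s')$ be the empirical frequency of $s'$ among the first $n$ of them, and put $$\xi(n)=\frac{\log(4n^2|\mathcal S|^2|\mathcal A|/\delta)}{n-1},\qquad \psi_{sas'}(n)=\sqrt{2\hat P_n(1-\hat P_n)\,\xi(n)}+\tfrac73\xi(n)\quad(\hat P_n=\hat P_n(s,a,s')).$$ Let $\mathcal E$ be the event that $|P(s,a,s')-\hat P_n(s,a,s')|\le\psi_{sas'}(n)$ for all $s,a,s'$ and all $n>1$. *PlanTransient with $n$ samples per state–action pair.* Let $\mathcal P(s,a)$ be the set of probability vectors $p$ on $\mathcal S$ with $p(s')=\hat P_n(s,a,s')$ whenever $\hat P_n(s,a,s')\in\{0,1\}$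 and $|p(s')-\hat P_n(s,a,s')|\le\psi_{sas'}(n)$ otherwise. Iterate the operator $$\mathcal Lx(s)=\begin{cases}\min\big\{\min_{a}\big(\mathcal C(s,a)+\min_{p\in\mathcal P(s,a)}p^{\top}x\big),\ \bar V/\epsilon_\varphi\big\},&s\in T,\\ \lambda g_i,&s\in A_i,\end{cases}$$ from $v_0=\lambda g_i$ on $A_i$, $v_0=0$ on $T$. Stop at an iterate $v'=v_j$ with $\|v_{j+1}-v_j\|_\infty\le\epsilon^{\mathcal L}$ and return a deterministic policy $\pi$ that is greedy with respect to $v'$ (on $T$ it chooses an action attaining $\min_a(\mathcal C(s,a)+\min_{p\in\mathcal P(s,a)}p^\top v')$). **Proposition.** Cost-optimal and reach-optimal policies exist, and $\Pr(\mathcal E)\ge1-\delta$. Moreover, there are universal constants $K>0$ and $q\in\mathbb N$ such that, in every such setting, with $$R=\frac{|\mathcal S\setminus\bigcup_iA_i|^2\,\bar V^4}{c_{\min}^2\,\epsilon_{\rm PT}^2\,\epsilon_\varphi^4},$$ the following holds on $\mathcal E$ for every $$n\ \ge\ K\,R\,\log^q\!\Big(2+\tfrac{R\,|\mathcal S||\mathcal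 A|}{\delta}\Big)=\tilde{\mathcal O}(R).$$ The value iteration converges, PlanTransient has an output, and every output $\pi$ satisfies $$\|\tilde V_\pi-\tilde V_{\pi'}\|_\infty<\epsilon_{\rm PT}\quad\text{for every cost-optimal }\pi',$$ $$\big|\Pr[\pi\text{ reaches }\textstyle\bigcup_iA_i\mid s_0=s]-\Pr[\pi'\text{ reaches }\bigcup_iA_i\mid s_0=s]\big|\le\epsilon_\varphi\quad\text{for every reach-optimal }\pi'\text{ and every }s\in\mathcal S.$$ -/

import Mathlib

open MeasureTheory ProbabilityTheory Filter Topology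

universe u v w

noncomputable section

/-- The data of a transient planning problem: a finite Markov decision process with true dynamics
`P` and costs `cost`, the input `(A_i, g_i)`, `i < k`, of the planner (a target component `comp i`
and its approximate gain `gain i`), the trade-off factor `lam`, the bound `Vbar`, and the
probability tolerance `epsPhi`. -/
structure TransientProblem (S : Type u) (A : Type v) where
  P : S → A → PMF S
  cost : S → A → ℝ
  k : ℕ
  comp : Fin k → Finset S
  gain : Fin k → ℝ
  lam : ℝ
  Vbar : ℝ
  epsPhi : ℝ

namespace TransientProblem

variable {S : Type u} {A : Type v} [Fintype S] [DecidableEq S] [Fintype A]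

/-- The union of the target components. -/
def goal (I : TransientProblem S A) : Finset S := Finset.univ.biUnion I.comp

/-- The transient states: those outside every target component. -/
def transient (I : TransientProblem S A) : Finset S := Finset.univ \ I.goal

/-- The terminal cost: `lam * gain i` on `comp i` (the components are pairwise disjoint),
and `0` on the transient states. -/
def terminal (I : TransientProblem S A) (s : S) : ℝ :=
  ∑ i, if s ∈ I.comp i then I.lam * I.gain i else 0

/-- The bound imposed on the value function. -/
def cap (I : TransientProblem S A) : ℝ := I.Vbar / I.epsPhi

/-- The deterministic stationary policy that plays `f s` in state `s`. -/
def detPolicy (f : S → A) : S → PMF A := fun s => PMF.pure (f s)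

/-! ### Values and reaching probabilities in the true dynamics -/

/-- The capped Bellman evaluation operator of a stationary randomized policy `π`. -/
def evalOp (I : TransientProblem S A) (π : S → PMF A) (x : S → ℝ) (s : S) : ℝ :=
  if s ∈ I.goal then I.terminal s
  else min (∑ a, (π s a).toReal * (I.cost s a + ∑ s', (I.P s a s').toReal * x s')) I.cap

/-- The modified stochastic-shortest-path value of `π`: the increasing limit of the iterates of
the capped Bellman evaluation operator, started from the terminal costs. -/
def value (I : TransientProblem S A) (π : S → PMF A) (s : S) : ℝ :=
  ⨆ j : ℕ, (I.evalOp π)^[j] I.terminal s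

/-- `π` minimizes the modified value, from every state, over all stationary policies. -/
def IsCostOptimal (I : TransientProblem S A) (π : S → PMF A) : Prop :=
  ∀ (π' : S → PMF A) (s : S), I.value π s ≤ I.value π' s

/-- The one-step kernel of the Markov chain that `π` induces. -/
def stepKernel [MeasurableSpace S] [MeasurableSingletonClass S]
    (I : TransientProblem S A) (π : S → PMF A) (t : ℕ) :
    Kernel ((_ : Finset.Iic t) → S) S :=
  Kernel.ofFunOfCountable fun h =>
    ((π (h ⟨t, Finset.mem_Iic.2 le_rfl⟩)).bind
      fun a => I.P (h ⟨t, Finset.mem_Iic.2 le_rfl⟩) a).toMeasure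

instance [MeasurableSpace S] [MeasurableSingletonClass S]
    (I : TransientProblem S A) (π : S → PMF A) (t : ℕ) :
    IsMarkovKernel (I.stepKernel π t) :=
  ⟨fun _ => PMF.toMeasure.isProbabilityMeasure _⟩

/-- The law of the trajectory `s₀, s₁, …` of `π` in the true dynamics, started at `s₀ = s`. -/
def trajLaw [MeasurableSpace S] [MeasurableSingletonClass S]
    (I : TransientProblem S A) (π : S → PMF A) (s : S) : Measure (ℕ → S) :=
  Kernel.traj (X := fun _ => S) (I.stepKernel π) 0 (fun _ => s)

/-- The probability that `π`, started at `s`, reaches the union of the target components. -/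
def reachProb [MeasurableSpace S] [MeasurableSingletonClass S]
    (I : TransientProblem S A) (π : S → PMF A) (s : S) : ℝ :=
  (I.trajLaw π s).real {τ | ∃ t, τ t ∈ I.goal}

/-- `π` maximizes the reaching probability, from every state, over all stationary policies. -/
def IsReachOptimal [MeasurableSpace S] [MeasurableSingletonClass S]
    (I : TransientProblem S A) (π : S → PMF A) : Prop :=
  ∀ (π' : S → PMF A) (s : S), I.reachProb π' s ≤ I.reachProb π s

/-! ### Confidence sets and optimistic planning from an empirical model -/

/-- `ξ(n) = log (4 n² |S|² |A| / δ) / (n - 1)`. -/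
def xi (S : Type u) (A : Type v) [Fintype S] [Fintype A] (δ : ℝ) (n : ℕ) : ℝ :=
  Real.log (4 * (n : ℝ) ^ 2 * (Fintype.card S : ℝ) ^ 2 * (Fintype.card A : ℝ) / δ) / ((n : ℝ) - 1)

/-- The confidence radius of an empirical transition probability `q` based on `n` samples. -/
def radius (S : Type u) (A : Type v) [Fintype S] [Fintype A] (δ : ℝ) (n : ℕ) (q : ℝ) : ℝ :=
  Real.sqrt (2 * q * (1 - q) * xi S A δ n) + 7 / 3 * xi S A δ n

/-- The plausible transition distributions around an empirical distribution `q`: within the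
confidence radius coordinatewise, and equal to `q` where `q` is `0` or `1`. -/
def plausible (A : Type v) [Fintype A] (δ : ℝ) (n : ℕ) (q : S → ℝ) : Set (S → ℝ) :=
  {p | p ∈ stdSimplex ℝ S ∧ ∀ s',
    if q s' = 0 ∨ q s' = 1 then p s' = q s' else |p s' - q s'| ≤ radius S A δ n (q s')}

/-- The optimistic one-step cost of action `a` in state `s`, given the value estimate `x`. -/
def optimisticQ (I : TransientProblem S A) (δ : ℝ) (n : ℕ) (Phat : S → A → S → ℝ)
    (x : S → ℝ) (s : S) (a : A) : ℝ :=
  I.cost s a + sInf ((fun p : S → ℝ => ∑ s', p s' * x s') '' plausible A δ n (Phat s a))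

/-- The capped optimistic Bellman operator. -/
def planOp (I : TransientProblem S A) (δ : ℝ) (n : ℕ) (Phat : S → A → S → ℝ)
    (x : S → ℝ) (s : S) : ℝ :=
  if s ∈ I.goal then I.terminal s else min (⨅ a, I.optimisticQ δ n Phat x s a) I.cap

/-- The iterates of optimistic value iteration, started from the terminal costs. -/
def viIter (I : TransientProblem S A) (δ : ℝ) (n : ℕ) (Phat : S → A → S → ℝ) (j : ℕ) : S → ℝ :=
  (I.planOp δ n Phat)^[j] I.terminal

/-- `f` is greedy with respect to the value estimate `x`. -/
def IsGreedy (I : TransientProblem S A) (δ : ℝ) (n : ℕ) (Phat : S → A → S → ℝ)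
    (x : S → ℝ) (f : S → A) : Prop :=
  ∀ s ∈ I.transient, ∀ a, I.optimisticQ δ n Phat x s (f s) ≤ I.optimisticQ δ n Phat x s a

/-- `f` is a possible output of the planner: value iteration is stopped at an iterate whose
Bellman residual is at most the accuracy `c_min ε_PT ε_φ / (4 Vbar)`, and `f` is greedy with
respect to that iterate. -/
def IsPlanOutput (I : TransientProblem S A) (δ cmin epsPT : ℝ) (n : ℕ) (Phat : S → A → S → ℝ)
    (f : S → A) : Prop :=
  ∃ j : ℕ,
    ‖I.viIter δ n Phat (j + 1) - I.viIter δ n Phat j‖ ≤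
        cmin * epsPT * I.epsPhi / (4 * I.Vbar) ∧
      I.IsGreedy δ n Phat (I.viIter δ n Phat j) f

/-! ### Sampling -/

/-- The empirical transition frequencies of the first `n` samples `X s a 0, …, X s a (n - 1)`. -/
def empirical {Ω : Type w} (X : S → A → ℕ → Ω → S) (n : ℕ) (ω : Ω) (s : S) (a : A) (s' : S) : ℝ :=
  (((Finset.range n).filter fun j => X s a j ω = s').card : ℝ) / n

/-- The event that all empirical frequencies, at all sample sizes `n > 1`, are within their
confidence radii of the true transition probabilities. -/
def goodEvent {Ω : Type w} (I : TransientProblem S A) (X : S → A → ℕ → Ω → S) (δ : ℝ) : Set Ω :=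
  {ω | ∀ (s : S) (a : A) (s' : S) (n : ℕ), 1 < n →
    |(I.P s a s').toReal - empirical X n ω s a s'| ≤ radius S A δ n (empirical X n ω s a s')}

/-- `|S ∖ ⋃ A_i|² Vbar⁴ / (c_min² ε_PT² ε_φ⁴)`. -/
def rate (I : TransientProblem S A) (cmin epsPT : ℝ) : ℝ :=
  (I.transient.card : ℝ) ^ 2 * I.Vbar ^ 4 / (cmin ^ 2 * epsPT ^ 2 * I.epsPhi ^ 4)

/-- A sample size of order `rate` up to the constant `K` and the `q`-th power of the logarithm
of `rate`, `|S|`, `|A|` and `1 / δ`. -/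
def sampleBound (I : TransientProblem S A) (K : ℝ) (q : ℕ) (δ cmin epsPT : ℝ) : ℝ :=
  K * I.rate cmin epsPT *
    Real.log (2 + I.rate cmin epsPT * Fintype.card S * Fintype.card A / δ) ^ q

end TransientProblem

end

set_option linter.unusedSectionVars false

noncomputable section

/-! On the good event, all that planning uses about the data is `IsAccurate`: the true rows are
plausible, and no plausible row undershoots a true probability by more than `ρ = 8 √ξ`. The first
half makes planning optimistic, so every iterate lies below the value of every policy
(`viIter_le_value`). It remains to bound from above, in the true dynamics, the value of a policy
greedy for the stopped iterate `v`.

Only undershooting hurts. Over transient successors it costs at most `ρ * cap * |T|` per step. A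
goal successor of positive probability has probability at least `β`, so raising `v` by `ρ * cap / β`
on the transient states alone pays for it (`cost_add_le_optimisticQ`); hence the rate involves
`|T|`, not `|S|`. The raised iterate is then a supersolution up to a per-step error `κ * cmin` with
`κ < 1`, and dividing it by `1 - κ` absorbs that error into the running cost (`value_greedy_le`).

For reaching probabilities, the cap acts as a penalty for never reaching the goal: a value is at
least `cap * failProb`, and exceeds it by at most the cost of forcing a hit along shortest paths
plus a terminal cost (`value_le_cap_mul_failProb_add`). Combining the upper bound for a
deterministic reach-optimal policy with a lower comparison for the raised iterate
(`cap_mul_failProb_greedy_le`), all overheads fit into `Vbar = epsPhi * cap`.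

The good event is handled by Chernoff's bound, a variance-sensitive lower bound on binary relative
entropy, and a union bound. Cost-optimal policies are greedy for the limit of optimal value
iteration; reach-optimal ones arise from cost-optimal ones as the step cost tends to zero. -/

theorem PMF.sum_toReal_eq_one {α : Type*} [Fintype α] (p : PMF α) : ∑ a, (p a).toReal = 1 := by
  rw [← ENNReal.toReal_sum fun a _ => p.apply_ne_top a, ← tsum_fintype (L := .unconditional α),
    p.tsum_coe, ENNReal.toReal_one]

theorem PMF.sum_pure_toReal_mul {α : Type*} [Fintype α] (b : α) (g : α → ℝ) :
    ∑ a, (PMF.pure b a).toReal * g a = g b := by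
  classical
  rw [Finset.sum_eq_single b]
  · simp
  · intro a _ hab
    simp [PMF.pure_apply, hab]
  · simp

/-! ### Monotone iterations -/

/-- A bounded orbit of a monotone self-map of `S → ℝ` which starts with an increase converges. -/
theorem tendsto_iterate_iSup {S : Type*} {F : (S → ℝ) → S → ℝ} (hF : Monotone F)
    {x : S → ℝ} (hx : x ≤ F x) {B : ℝ} (hB : ∀ j s, F^[j] x s ≤ B) :
    Tendsto (fun j => F^[j] x) atTop (𝓝 fun s => ⨆ j, F^[j] x s) := by
  rw [tendsto_pi_nhds]
  intro s
  refine tendsto_atTop_ciSup (fun i j hij => hF.monotone_iterate_of_le_map hx hij s) ?_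
  exact ⟨B, by rintro _ ⟨j, rfl⟩; exact hB j s⟩

theorem map_iSup_iterate {S : Type*} {F : (S → ℝ) → S → ℝ} (hF : Monotone F) (hc : Continuous F)
    {x : S → ℝ} (hx : x ≤ F x) {B : ℝ} (hB : ∀ j s, F^[j] x s ≤ B) :
    (F fun s => ⨆ j, F^[j] x s) = fun s => ⨆ j, F^[j] x s := by
  have h := tendsto_iterate_iSup hF hx hB
  have h1 := (hc.tendsto _).comp h
  have h2 : Tendsto (fun j => F^[j + 1] x) atTop (𝓝 fun s => ⨆ j, F^[j] x s) :=
    (tendsto_add_atTop_iff_nat 1).2 h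
  refine tendsto_nhds_unique h1 (h2.congr fun j => ?_)
  rw [Function.iterate_succ_apply', Function.comp_apply]

theorem iterate_le_of_map_le {S : Type*} {F : (S → ℝ) → S → ℝ} (hF : Monotone F)
    {x y : S → ℝ} (hxy : x ≤ y) (hy : F y ≤ y) (j : ℕ) : F^[j] x ≤ y := by
  induction j with
  | zero => exact hxy
  | succ j ih =>
    rw [Function.iterate_succ_apply']
    exact (hF ih).trans hy

theorem iterate_le_iterate_of_le {S : Type*} {F G : (S → ℝ) → S → ℝ} (hF : Monotone F)
    {x : S → ℝ} (h : ∀ j, F (G^[j] x) ≤ G (G^[j] x)) (j : ℕ) : F^[j] x ≤ G^[j] x := by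
  induction j with
  | zero => exact le_rfl
  | succ j ih =>
    rw [Function.iterate_succ_apply', Function.iterate_succ_apply']
    exact (hF ih).trans (h j)

/-! ### Fixed points of the capped Bellman operators -/

namespace TransientProblem

variable {S : Type u} {A : Type v} [Fintype S] [DecidableEq S] [Fintype A]

/-- The transition matrix of the Markov chain induced by `π`. -/
def trans (I : TransientProblem S A) (π : S → PMF A) (s s' : S) : ℝ :=
  ∑ a, (π s a).toReal * (I.P s a s').toReal

/-- The expected one-step cost of `π`. -/
def stageCost (I : TransientProblem S A) (π : S → PMF A) (s : S) : ℝ :=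
  ∑ a, (π s a).toReal * I.cost s a

/-- The standing positivity and boundedness assumptions on costs and terminal costs. -/
structure IsAdmissible (I : TransientProblem S A) (cmin : ℝ) : Prop where
  cmin_pos : 0 < cmin
  cmin_le : ∀ s a, cmin ≤ I.cost s a
  terminal_nonneg : ∀ s, 0 ≤ I.terminal s
  terminal_le : ∀ s, I.terminal s ≤ I.cap

variable {I : TransientProblem S A} {π : S → PMF A} {cmin : ℝ}

theorem mem_transient {s : S} : s ∈ I.transient ↔ s ∉ I.goal := by
  simp [transient]

theorem terminal_of_notMem_goal {s : S} (hs : s ∉ I.goal) : I.terminal s = 0 := by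
  refine Finset.sum_eq_zero fun i _ => if_neg fun hi => hs ?_
  exact Finset.mem_biUnion.2 ⟨i, Finset.mem_univ i, hi⟩

theorem trans_nonneg (s s' : S) : 0 ≤ I.trans π s s' :=
  Finset.sum_nonneg fun _ _ => mul_nonneg ENNReal.toReal_nonneg ENNReal.toReal_nonneg

theorem sum_trans (s : S) : ∑ s', I.trans π s s' = 1 := by
  unfold trans
  rw [Finset.sum_comm]
  simp_rw [← Finset.mul_sum, PMF.sum_toReal_eq_one, mul_one]
  exact PMF.sum_toReal_eq_one _

theorem trans_detPolicy (f : S → A) (s s' : S) :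
    I.trans (detPolicy f) s s' = (I.P s (f s) s').toReal :=
  PMF.sum_pure_toReal_mul (f s) fun a => (I.P s a s').toReal

theorem stageCost_detPolicy (f : S → A) (s : S) : I.stageCost (detPolicy f) s = I.cost s (f s) :=
  PMF.sum_pure_toReal_mul (f s) fun a => I.cost s a

theorem sum_trans_mul_mono {x y : S → ℝ} (h : x ≤ y) (s : S) :
    ∑ s', I.trans π s s' * x s' ≤ ∑ s', I.trans π s s' * y s' :=
  Finset.sum_le_sum fun s' _ => mul_le_mul_of_nonneg_left (h s') (trans_nonneg s s')

theorem sum_trans_mul_const (s : S) (b : ℝ) : ∑ s', I.trans π s s' * b = b := by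
  rw [← Finset.sum_mul, sum_trans, one_mul]

theorem le_stageCost (hI : I.IsAdmissible cmin) (s : S) : cmin ≤ I.stageCost π s := by
  calc cmin = ∑ a, (π s a).toReal * cmin := by
        rw [← Finset.sum_mul, PMF.sum_toReal_eq_one, one_mul]
    _ ≤ _ := Finset.sum_le_sum fun a _ =>
        mul_le_mul_of_nonneg_left (hI.cmin_le s a) ENNReal.toReal_nonneg

theorem stageCost_le {cmax : ℝ} (h : ∀ s a, I.cost s a ≤ cmax) (s : S) :
    I.stageCost π s ≤ cmax := by
  calc _ ≤ ∑ a, (π s a).toReal * cmax := Finset.sum_le_sum fun a _ =>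
        mul_le_mul_of_nonneg_left (h s a) ENNReal.toReal_nonneg
    _ = cmax := by rw [← Finset.sum_mul, PMF.sum_toReal_eq_one, one_mul]

theorem evalOp_apply (x : S → ℝ) (s : S) :
    I.evalOp π x s = if s ∈ I.goal then I.terminal s
      else min (I.stageCost π s + ∑ s', I.trans π s s' * x s') I.cap := by
  have h : ∑ a, (π s a).toReal * (I.cost s a + ∑ s', (I.P s a s').toReal * x s') =
      I.stageCost π s + ∑ s', I.trans π s s' * x s' := by
    simp_rw [mul_add, Finset.sum_add_distrib, stageCost, trans, Finset.sum_mul, Finset.mul_sum]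
    rw [Finset.sum_comm (s := (Finset.univ : Finset S))]
    simp_rw [mul_assoc]
  rw [evalOp, h]

theorem evalOp_mono : Monotone (I.evalOp π) := by
  intro x y h s
  rw [evalOp_apply, evalOp_apply]
  split_ifs
  · exact le_rfl
  · exact min_le_min (add_le_add le_rfl (sum_trans_mul_mono h s)) le_rfl

theorem continuous_evalOp : Continuous (I.evalOp π) := by
  refine continuous_pi fun s => ?_
  simp_rw [evalOp_apply]
  split_ifs <;> fun_prop

theorem evalOp_le_cap (hI : I.IsAdmissible cmin) (x : S → ℝ) (s : S) : I.evalOp π x s ≤ I.cap := by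
  rw [evalOp_apply]
  split_ifs
  · exact hI.terminal_le s
  · exact min_le_right _ _

theorem terminal_le_evalOp (hI : I.IsAdmissible cmin) : I.terminal ≤ I.evalOp π I.terminal := by
  intro s
  rw [evalOp_apply]
  split_ifs with hs
  · exact le_rfl
  · rw [terminal_of_notMem_goal hs]
    have h1 : 0 ≤ ∑ s', I.trans π s s' * I.terminal s' :=
      Finset.sum_nonneg fun s' _ => mul_nonneg (trans_nonneg s s') (hI.terminal_nonneg s')
    exact le_min (by linarith [hI.cmin_pos, le_stageCost (π := π) hI s])
      ((hI.terminal_nonneg s).trans (hI.terminal_le s))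

theorem iterate_evalOp_le_cap (hI : I.IsAdmissible cmin) (j : ℕ) (s : S) :
    (I.evalOp π)^[j] I.terminal s ≤ I.cap := by
  cases j with
  | zero => exact hI.terminal_le s
  | succ j =>
    rw [Function.iterate_succ_apply']
    exact evalOp_le_cap hI _ s

theorem evalOp_value (hI : I.IsAdmissible cmin) : I.evalOp π (I.value π) = I.value π :=
  map_iSup_iterate evalOp_mono continuous_evalOp (terminal_le_evalOp hI)
    (iterate_evalOp_le_cap hI)

theorem iterate_le_value (hI : I.IsAdmissible cmin) (j : ℕ) (s : S) :
    (I.evalOp π)^[j] I.terminal s ≤ I.value π s :=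
  le_ciSup (f := fun j => (I.evalOp π)^[j] I.terminal s)
    ⟨I.cap, by rintro _ ⟨j, rfl⟩; exact iterate_evalOp_le_cap hI j s⟩ j

/-- Supersolutions dominate the value because it is a limit of monotone iterates from below. All
upper bounds on values come from here, and uniqueness of the fixed point is never needed. -/
theorem value_le_of_evalOp_le {y : S → ℝ} (h0 : I.terminal ≤ y) (h : I.evalOp π y ≤ y) :
    I.value π ≤ y :=
  fun s => ciSup_le fun j => iterate_le_of_map_le evalOp_mono h0 h j s

theorem value_le_cap (hI : I.IsAdmissible cmin) (s : S) : I.value π s ≤ I.cap :=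
  ciSup_le fun j => iterate_evalOp_le_cap hI j s

theorem value_nonneg (hI : I.IsAdmissible cmin) (s : S) : 0 ≤ I.value π s :=
  (hI.terminal_nonneg s).trans (iterate_le_value hI 0 s)

/-- Maximum principle: a function which is strictly subharmonic wherever it exceeds `m` is at
most `m`. -/
theorem le_of_lt_sum_trans {g : S → ℝ} {m : ℝ}
    (h : ∀ s, g s ≤ m ∨ g s < ∑ s', I.trans π s s' * g s') (s : S) : g s ≤ m := by
  obtain ⟨t, -, ht⟩ := Finset.exists_max_image Finset.univ g ⟨s, Finset.mem_univ s⟩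
  refine (ht s (Finset.mem_univ s)).trans ((h t).resolve_right fun hlt => ?_)
  have h1 := sum_trans_mul_mono (I := I) (π := π) (x := g) (y := fun _ => g t)
    (fun s' => ht s' (Finset.mem_univ s')) t
  rw [sum_trans_mul_const] at h1
  exact absurd hlt (not_lt.2 h1)

/-! ### Existence of cost-optimal policies -/

variable [Nonempty A]

/-- The capped Bellman optimality operator. -/
def optOp (I : TransientProblem S A) (x : S → ℝ) (s : S) : ℝ :=
  if s ∈ I.goal then I.terminal s
  else min (Finset.univ.inf' Finset.univ_nonempty
    fun a => I.cost s a + ∑ s', (I.P s a s').toReal * x s') I.cap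

theorem optOp_mono : Monotone I.optOp := by
  intro x y h s
  unfold optOp
  split_ifs
  · exact le_rfl
  · refine min_le_min (Finset.inf'_mono_fun fun a _ => ?_) le_rfl
    exact add_le_add le_rfl (Finset.sum_le_sum fun s' _ =>
      mul_le_mul_of_nonneg_left (h s') ENNReal.toReal_nonneg)

theorem continuous_optOp : Continuous I.optOp := by
  refine continuous_pi fun s => ?_
  unfold optOp
  split_ifs
  · fun_prop
  · refine Continuous.min (Continuous.finset_inf'_apply _ fun a _ => ?_) continuous_const
    fun_prop

theorem optOp_le_evalOp (π : S → PMF A) (x : S → ℝ) : I.optOp x ≤ I.evalOp π x := by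
  intro s
  unfold optOp evalOp
  split_ifs
  · exact le_rfl
  · refine min_le_min ?_ le_rfl
    calc _ = ∑ a, (π s a).toReal * Finset.univ.inf' Finset.univ_nonempty
          (fun a => I.cost s a + ∑ s', (I.P s a s').toReal * x s') := by
          rw [← Finset.sum_mul, PMF.sum_toReal_eq_one, one_mul]
      _ ≤ _ := Finset.sum_le_sum fun a _ =>
          mul_le_mul_of_nonneg_left (Finset.inf'_le _ (Finset.mem_univ a)) ENNReal.toReal_nonneg

theorem exists_evalOp_eq_optOp (I : TransientProblem S A) (x : S → ℝ) :
    ∃ f : S → A, I.evalOp (detPolicy f) x = I.optOp x := by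
  have h : ∀ s, ∃ a, Finset.univ.inf' Finset.univ_nonempty
      (fun a => I.cost s a + ∑ s', (I.P s a s').toReal * x s') =
      I.cost s a + ∑ s', (I.P s a s').toReal * x s' := fun s => by
    obtain ⟨a, -, ha⟩ := Finset.exists_mem_eq_inf' (Finset.univ_nonempty (α := A))
      (fun a => I.cost s a + ∑ s', (I.P s a s').toReal * x s')
    exact ⟨a, ha⟩
  choose f hf using h
  refine ⟨f, funext fun s => ?_⟩
  rw [evalOp_apply, stageCost_detPolicy, optOp, hf]
  simp_rw [trans_detPolicy]

/-- The limit of the iterates of `optOp` lies below every policy's value, and is itself a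
supersolution for a policy greedy with respect to it. -/
theorem exists_isCostOptimal (hI : I.IsAdmissible cmin) :
    ∃ f : S → A, I.IsCostOptimal (detPolicy f) := by
  have h0 : I.terminal ≤ I.optOp I.terminal := by
    obtain ⟨f, hf⟩ := I.exists_evalOp_eq_optOp I.terminal
    exact hf ▸ terminal_le_evalOp hI
  have hle : ∀ (π : S → PMF A) j, I.optOp^[j] I.terminal ≤ (I.evalOp π)^[j] I.terminal :=
    fun π => iterate_le_iterate_of_le optOp_mono fun j => optOp_le_evalOp π _
  obtain ⟨a⟩ := ‹Nonempty A›
  have hB : ∀ j s, I.optOp^[j] I.terminal s ≤ I.cap := fun j s =>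
    (hle (detPolicy fun _ => a) j s).trans (iterate_evalOp_le_cap hI j s)
  have hfix := map_iSup_iterate optOp_mono continuous_optOp h0 hB
  obtain ⟨f, hf⟩ := I.exists_evalOp_eq_optOp fun s => ⨆ j, I.optOp^[j] I.terminal s
  refine ⟨f, fun π s => ?_⟩
  have h1 : I.value (detPolicy f) ≤ fun s => ⨆ j, I.optOp^[j] I.terminal s := by
    refine value_le_of_evalOp_le (fun s => ?_) (hf.trans hfix).le
    exact le_ciSup (f := fun j => I.optOp^[j] I.terminal s)
      ⟨I.cap, by rintro _ ⟨j, rfl⟩; exact hB j s⟩ 0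
  exact (h1 s).trans (ciSup_le fun j => (hle π j s).trans (iterate_le_value hI j s))

end TransientProblem

/-! ### Hitting probabilities and the trajectory law -/

namespace TransientProblem

variable {S : Type u} {A : Type v} [Fintype S] [DecidableEq S] [Fintype A]
variable {I : TransientProblem S A} {π : S → PMF A}

/-- One-step recursion for the probability of hitting the goal. -/
def hitOp (I : TransientProblem S A) (π : S → PMF A) (x : S → ℝ) (s : S) : ℝ :=
  if s ∈ I.goal then 1 else ∑ s', I.trans π s s' * x s'

/-- The probability of hitting the goal within `j` steps. -/
def hitBy (I : TransientProblem S A) (π : S → PMF A) (j : ℕ) : S → ℝ :=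
  (I.hitOp π)^[j] fun s => if s ∈ I.goal then 1 else 0

theorem hitBy_zero (s : S) : I.hitBy π 0 s = if s ∈ I.goal then 1 else 0 := rfl

theorem hitBy_succ (j : ℕ) (s : S) : I.hitBy π (j + 1) s =
    if s ∈ I.goal then 1 else ∑ s', I.trans π s s' * I.hitBy π j s' := by
  rw [hitBy, Function.iterate_succ_apply']
  rfl

theorem hitBy_of_mem_goal {s : S} (hs : s ∈ I.goal) (j : ℕ) : I.hitBy π j s = 1 := by
  cases j <;> simp [hitBy_zero, hitBy_succ, hs]

theorem hitBy_nonneg (j : ℕ) (s : S) : 0 ≤ I.hitBy π j s := by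
  induction j generalizing s with
  | zero => rw [hitBy_zero]; split_ifs <;> norm_num
  | succ j ih =>
    rw [hitBy_succ]
    split_ifs
    · norm_num
    · exact Finset.sum_nonneg fun s' _ => mul_nonneg (trans_nonneg s s') (ih s')

section Trajectory

variable [MeasurableSpace S] [MeasurableSingletonClass S]

theorem bind_toReal (s s' : S) :
    (((π s).bind fun a => I.P s a) s').toReal = I.trans π s s' := by
  rw [PMF.bind_apply, tsum_fintype, ENNReal.toReal_sum]
  · simp_rw [ENNReal.toReal_mul, trans]
  · exact fun a _ => ENNReal.mul_ne_top ((π s).apply_ne_top a) ((I.P s a).apply_ne_top s')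

theorem lintegral_stepKernel (t : ℕ) (h : (_ : Finset.Iic t) → S) (g : S → ℝ) (hg : ∀ s, 0 ≤ g s) :
    ∫⁻ s', ENNReal.ofReal (g s') ∂(I.stepKernel π t h) =
      ENNReal.ofReal (∑ s', I.trans π (h ⟨t, Finset.mem_Iic.2 le_rfl⟩) s' * g s') := by
  rw [lintegral_fintype, ENNReal.ofReal_sum_of_nonneg
    fun s' _ => mul_nonneg (trans_nonneg _ s') (hg s')]
  refine Finset.sum_congr rfl fun s' _ => ?_
  have h1 : I.stepKernel π t h {s'} =
      ((π (h ⟨t, Finset.mem_Iic.2 le_rfl⟩)).bind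
        fun a => I.P (h ⟨t, Finset.mem_Iic.2 le_rfl⟩) a) s' :=
    PMF.toMeasure_apply_singleton _ _ (measurableSet_singleton s')
  rw [h1, mul_comm (I.trans π _ s'), ENNReal.ofReal_mul (hg s'), ← bind_toReal,
    ENNReal.ofReal_toReal (PMF.apply_ne_top _ _)]

/-- The probability of hitting the goal before time `j`, or within the next `k` steps after it,
given the trajectory up to time `j`. -/
def hitGiven (I : TransientProblem S A) (π : S → PMF A) (j k : ℕ) (h : (_ : Finset.Iic j) → S) :
    ℝ :=
  if ∃ i, h i ∈ I.goal then 1 else I.hitBy π k (h ⟨j, Finset.mem_Iic.2 le_rfl⟩)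

instance (s : S) : IsProbabilityMeasure (I.trajLaw π s) := by
  unfold trajLaw; infer_instance

theorem hitGiven_succ_eq (j k : ℕ) (τ : ℕ → S) :
    I.hitGiven π (j + 1) k (Preorder.frestrictLe (π := fun _ => S) (j + 1) τ) =
      if ∃ i, Preorder.frestrictLe (π := fun _ => S) j τ i ∈ I.goal then 1
      else I.hitBy π k (τ (j + 1)) := by
  unfold hitGiven
  by_cases h : ∃ i, Preorder.frestrictLe (π := fun _ => S) j τ i ∈ I.goal
  · rw [if_pos h, if_pos]
    obtain ⟨⟨i, hi⟩, h⟩ := h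
    exact ⟨⟨i, Finset.mem_Iic.2 ((Finset.mem_Iic.1 hi).trans j.le_succ)⟩, h⟩
  · rw [if_neg h]
    by_cases h1 : τ (j + 1) ∈ I.goal
    · rw [hitBy_of_mem_goal h1, if_pos ⟨⟨j + 1, Finset.mem_Iic.2 le_rfl⟩, h1⟩]
    · rw [if_neg]
      · rfl
      rintro ⟨⟨i, hi⟩, h2⟩
      rcases (Finset.mem_Iic.1 hi).lt_or_eq with h3 | h3
      · exact h ⟨⟨i, Finset.mem_Iic.2 (Nat.lt_succ_iff.1 h3)⟩, h2⟩
      · subst h3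
        exact h1 h2

/-- Tower property: conditioning on the trajectory up to time `j` and integrating the next step
gives exactly the recursion of `hitBy`. Iterating it moves the whole horizon from the recursion into
the trajectory law. -/
theorem lintegral_hitGiven_succ (s : S) (j k : ℕ) :
    ∫⁻ τ, ENNReal.ofReal (I.hitGiven π (j + 1) k (Preorder.frestrictLe (π := fun _ => S) (j + 1) τ))
        ∂(I.trajLaw π s) =
      ∫⁻ τ, ENNReal.ofReal (I.hitGiven π j (k + 1) (Preorder.frestrictLe (π := fun _ => S) j τ))
        ∂(I.trajLaw π s) := by
  have hcomp := Kernel.partialTraj_compProd_eq_map_traj (κ := I.stepKernel π) (X := fun _ => S)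
    (Nat.zero_le j) (x₀ := fun _ => s)
  set F : ((_ : Finset.Iic j) → S) × S → ENNReal := fun p =>
    ENNReal.ofReal (if ∃ i, p.1 i ∈ I.goal then 1 else I.hitBy π k p.2) with hF
  have hFm : Measurable F := measurable_of_countable _
  have h1 : ∫⁻ τ, ENNReal.ofReal (I.hitGiven π (j + 1) k
        (Preorder.frestrictLe (π := fun _ => S) (j + 1) τ)) ∂(I.trajLaw π s) =
      ∫⁻ p, F p ∂((I.trajLaw π s).map
        fun τ => (Preorder.frestrictLe (π := fun _ => S) j τ, τ (j + 1))) := by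
    rw [lintegral_map hFm (by fun_prop)]
    simp_rw [hitGiven_succ_eq, hF]
  have h2 : ∫⁻ τ, ENNReal.ofReal (I.hitGiven π j (k + 1)
        (Preorder.frestrictLe (π := fun _ => S) j τ)) ∂(I.trajLaw π s) =
      ∫⁻ h, ENNReal.ofReal (I.hitGiven π j (k + 1) h)
        ∂(Kernel.partialTraj (X := fun _ => S) (I.stepKernel π) 0 j (fun _ => s)) := by
    rw [← Kernel.traj_map_frestrictLe, Kernel.map_apply _ (by fun_prop),
      lintegral_map (measurable_of_countable _) (by fun_prop)]
    rfl
  rw [h1, h2]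
  unfold trajLaw
  rw [← hcomp, Measure.lintegral_compProd hFm]
  refine lintegral_congr fun h => ?_
  by_cases hh : ∃ i, h i ∈ I.goal
  · simp only [hF, hitGiven, if_pos hh]
    simp
  · simp only [hF, hitGiven, if_neg hh]
    rw [lintegral_stepKernel _ _ _ (hitBy_nonneg k), hitBy_succ, if_neg]
    exact fun h3 => hh ⟨_, h3⟩

theorem lintegral_hitGiven (s : S) (j k : ℕ) :
    ∫⁻ τ, ENNReal.ofReal (I.hitGiven π j k (Preorder.frestrictLe (π := fun _ => S) j τ))
        ∂(I.trajLaw π s) = ENNReal.ofReal (I.hitBy π (j + k) s) := by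
  induction j generalizing k with
  | zero =>
    have h2 : ∫⁻ τ, ENNReal.ofReal (I.hitGiven π 0 k
          (Preorder.frestrictLe (π := fun _ => S) 0 τ)) ∂(I.trajLaw π s) =
        ∫⁻ h, ENNReal.ofReal (I.hitGiven π 0 k h)
          ∂(Kernel.partialTraj (X := fun _ => S) (I.stepKernel π) 0 0 (fun _ => s)) := by
      rw [← Kernel.traj_map_frestrictLe, Kernel.map_apply _ (by fun_prop),
        lintegral_map (measurable_of_countable _) (by fun_prop)]
      rfl
    rw [h2, Kernel.partialTraj_self, Kernel.id_apply, lintegral_dirac, zero_add, hitGiven]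
    split_ifs with h
    · obtain ⟨_, h⟩ := h
      rw [hitBy_of_mem_goal h]
    · rfl
  | succ j ih => rw [lintegral_hitGiven_succ, ih, Nat.succ_add_eq_add_succ]

theorem trajLaw_hit_le (s : S) (j : ℕ) :
    I.trajLaw π s {τ | ∃ t ≤ j, τ t ∈ I.goal} = ENNReal.ofReal (I.hitBy π j s) := by
  have hm : MeasurableSet {τ : ℕ → S | ∃ t ≤ j, τ t ∈ I.goal} := by
    have : {τ : ℕ → S | ∃ t ≤ j, τ t ∈ I.goal} =
        ⋃ t ∈ Set.Iic j, (fun τ : ℕ → S => τ t) ⁻¹' (I.goal : Set S) := by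
      ext τ; simp
    rw [this]
    exact MeasurableSet.biUnion (Set.to_countable _) fun t _ =>
      measurable_pi_apply t (Set.toFinite _).measurableSet
  rw [← lintegral_indicator_one hm, ← add_zero j, ← lintegral_hitGiven s j 0, add_zero]
  refine lintegral_congr fun τ => ?_
  unfold hitGiven
  by_cases h : ∃ t ≤ j, τ t ∈ I.goal
  · rw [Set.indicator_of_mem (by exact h), if_pos]
    · simp
    · obtain ⟨t, ht, h⟩ := h
      exact ⟨⟨t, Finset.mem_Iic.2 ht⟩, h⟩
  · rw [Set.indicator_of_notMem (by exact h), if_neg, hitBy_zero, if_neg]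
    · simp
    · exact fun h3 => h ⟨j, le_rfl, h3⟩
    · rintro ⟨⟨t, ht⟩, h2⟩
      exact h ⟨t, Finset.mem_Iic.1 ht, h2⟩

theorem tendsto_hitBy (s : S) :
    Tendsto (fun j => I.hitBy π j s) atTop (𝓝 (I.reachProb π s)) := by
  have h1 : {τ : ℕ → S | ∃ t, τ t ∈ I.goal} = ⋃ j, {τ | ∃ t ≤ j, τ t ∈ I.goal} := by
    ext τ
    simp only [Set.mem_ofPred_eq, Set.mem_iUnion]
    exact ⟨fun ⟨t, h⟩ => ⟨t, t, le_rfl, h⟩, fun ⟨_, t, _, h⟩ => ⟨t, h⟩⟩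
  have h2 : Monotone fun j => {τ : ℕ → S | ∃ t ≤ j, τ t ∈ I.goal} :=
    fun i j hij τ ⟨t, ht, h⟩ => ⟨t, ht.trans hij, h⟩
  have h3 := tendsto_measure_iUnion_atTop (μ := I.trajLaw π s) h2
  rw [← h1] at h3
  have h4 := (ENNReal.tendsto_toReal (measure_ne_top _ _)).comp h3
  refine h4.congr fun j => ?_
  rw [Function.comp_apply, Function.comp_apply, trajLaw_hit_le,
    ENNReal.toReal_ofReal (hitBy_nonneg _ _)]

theorem reachProb_nonneg (s : S) : 0 ≤ I.reachProb π s := measureReal_nonneg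

theorem reachProb_le_one (s : S) : I.reachProb π s ≤ 1 := measureReal_le_one

theorem reachProb_of_mem_goal {s : S} (hs : s ∈ I.goal) : I.reachProb π s = 1 :=
  tendsto_nhds_unique (tendsto_hitBy s)
    (tendsto_const_nhds.congr fun j => (hitBy_of_mem_goal hs j).symm)

theorem reachProb_of_notMem_goal {s : S} (hs : s ∉ I.goal) :
    I.reachProb π s = ∑ s', I.trans π s s' * I.reachProb π s' := by
  have h1 : Tendsto (fun j => I.hitBy π (j + 1) s) atTop (𝓝 (I.reachProb π s)) :=
    (tendsto_add_atTop_iff_nat (f := fun j => I.hitBy π j s) 1).2 (tendsto_hitBy s)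
  refine tendsto_nhds_unique h1 ?_
  simp_rw [hitBy_succ, if_neg hs]
  exact tendsto_finsetSum _ fun s' _ => (tendsto_hitBy s').const_mul _

theorem exists_hitBy_pos {s : S} (hs : 0 < I.reachProb π s) : ∃ j, 0 < I.hitBy π j s :=
  ((tendsto_hitBy s).eventually (lt_mem_nhds hs)).exists

/-- The probability that `π`, started at `s`, never reaches the goal. -/
def failProb (I : TransientProblem S A) (π : S → PMF A) (s : S) : ℝ := 1 - I.reachProb π s

theorem failProb_nonneg (s : S) : 0 ≤ I.failProb π s := sub_nonneg.2 (reachProb_le_one s)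

theorem failProb_le_one (s : S) : I.failProb π s ≤ 1 := sub_le_self _ (reachProb_nonneg s)

theorem failProb_of_mem_goal {s : S} (hs : s ∈ I.goal) : I.failProb π s = 0 := by
  rw [failProb, reachProb_of_mem_goal hs, sub_self]

theorem failProb_of_notMem_goal {s : S} (hs : s ∉ I.goal) :
    I.failProb π s = ∑ s', I.trans π s s' * I.failProb π s' := by
  simp_rw [failProb, mul_sub, Finset.sum_sub_distrib, sum_trans_mul_const]
  rw [← reachProb_of_notMem_goal hs]

end Trajectory

end TransientProblem

namespace TransientProblem

variable {S : Type u} {A : Type v} [Fintype S] [DecidableEq S] [Fintype A]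
variable {I : TransientProblem S A} {π : S → PMF A} {cmin : ℝ}

/-! ### Distance to the goal -/

/-- The least number of steps in which `π` hits the goal with positive probability. -/
def level (I : TransientProblem S A) (π : S → PMF A) (s : S) : ℕ := sInf {j | 0 < I.hitBy π j s}

theorem hitBy_level_pos {s : S} (h : ∃ j, 0 < I.hitBy π j s) :
    0 < I.hitBy π (I.level π s) s := Nat.sInf_mem (s := {j | 0 < I.hitBy π j s}) h

theorem level_le {s : S} {j : ℕ} (h : 0 < I.hitBy π j s) : I.level π s ≤ j :=
  Nat.sInf_le (s := {j | 0 < I.hitBy π j s}) h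

theorem level_of_mem_goal {s : S} (hs : s ∈ I.goal) : I.level π s = 0 := by
  have h : 0 < I.hitBy π 0 s := by rw [hitBy_of_mem_goal hs]; exact one_pos
  exact Nat.le_zero.1 (level_le h)

theorem exists_level_eq_succ {s : S} (hs : s ∉ I.goal) (h : ∃ j, 0 < I.hitBy π j s) :
    ∃ s', I.trans π s s' ≠ 0 ∧ (∃ j, 0 < I.hitBy π j s') ∧ I.level π s = I.level π s' + 1 := by
  have h1 := hitBy_level_pos h
  obtain ⟨k, hk⟩ : ∃ k, I.level π s = k + 1 := by
    refine Nat.exists_eq_succ_of_ne_zero fun h0 => ?_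
    rw [h0, hitBy_zero, if_neg hs] at h1
    exact lt_irrefl _ h1
  rw [hk, hitBy_succ, if_neg hs] at h1
  obtain ⟨s', -, hs'⟩ := Finset.exists_ne_zero_of_sum_ne_zero h1.ne'
  have ht : 0 < I.trans π s s' := (trans_nonneg s s').lt_of_ne' (left_ne_zero_of_mul hs')
  have hp : 0 < I.hitBy π k s' := (hitBy_nonneg k s').lt_of_ne' (right_ne_zero_of_mul hs')
  refine ⟨s', ht.ne', ⟨k, hp⟩, le_antisymm ?_ (hk ▸ Nat.succ_le_succ (level_le hp))⟩
  apply level_le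
  rw [hitBy_succ, if_neg hs]
  exact Finset.sum_pos' (fun t _ => mul_nonneg (trans_nonneg s t) (hitBy_nonneg _ t))
    ⟨s', Finset.mem_univ s', mul_pos ht (hitBy_level_pos ⟨k, hp⟩)⟩

theorem exists_transient_level_eq {i k : ℕ} (hi : 1 ≤ i) {s : S}
    (h : ∃ j, 0 < I.hitBy π j s) (hk : I.level π s = i + k) :
    ∃ t ∈ I.transient, I.level π t = i := by
  have hs : s ∉ I.goal := fun hs => by
    rw [level_of_mem_goal hs] at hk
    omega
  induction k generalizing s with
  | zero => exact ⟨s, mem_transient.2 hs, hk⟩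
  | succ k ih =>
    obtain ⟨s', -, h', hl⟩ := exists_level_eq_succ hs h
    refine ih h' (by omega) fun hs' => ?_
    rw [level_of_mem_goal hs'] at hl
    omega

/-- A shortest path descends one level at a time, so each level from `1` to `level π s` is attained
at some transient state. -/
theorem level_le_card {s : S} (h : ∃ j, 0 < I.hitBy π j s) :
    I.level π s ≤ I.transient.card := by
  have h1 : Finset.Icc 1 (I.level π s) ⊆ I.transient.image (I.level π) := by
    intro i hi
    obtain ⟨hi1, hi2⟩ := Finset.mem_Icc.1 hi
    obtain ⟨k, hk⟩ := Nat.exists_eq_add_of_le hi2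
    obtain ⟨t, ht, hti⟩ := exists_transient_level_eq hi1 h hk
    exact Finset.mem_image.2 ⟨t, ht, hti⟩
  simpa using (Finset.card_le_card h1).trans Finset.card_image_le

/-! ### Value and failure probability -/

/-- `b⁻¹ + b⁻² + ⋯ + b⁻ᵏ`, the mean waiting time for `k` consecutive successes. -/
def waitTime (b : ℝ) (k : ℕ) : ℝ := ∑ i ∈ Finset.range k, b⁻¹ ^ (i + 1)

theorem waitTime_nonneg {b : ℝ} (hb : 0 < b) (k : ℕ) : 0 ≤ waitTime b k :=
  Finset.sum_nonneg fun _ _ => by positivity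

theorem mul_waitTime_succ {b : ℝ} (hb : 0 < b) (k : ℕ) :
    b * waitTime b (k + 1) = 1 + waitTime b k := by
  rw [waitTime, Finset.sum_range_succ', mul_add, Finset.mul_sum, waitTime, add_comm]
  congr 1
  · simp [hb.ne']
  · refine Finset.sum_congr rfl fun i _ => ?_
    rw [pow_succ' b⁻¹ (i + 1), ← mul_assoc, mul_inv_cancel₀ hb.ne', one_mul]

theorem waitTime_mono {b : ℝ} (hb : 0 < b) : Monotone (waitTime b) := fun _ _ h =>
  Finset.sum_le_sum_of_subset_of_nonneg (Finset.range_subset_range.2 h) fun _ _ _ => by positivity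

section Reach

variable [MeasurableSpace S] [MeasurableSingletonClass S]

/-- `failProb` is harmonic off the goal while an uncapped value pays a positive cost there, so the
difference is strictly subharmonic wherever it could be positive, and the maximum principle applies.
-/
theorem cap_mul_failProb_le_value (hI : I.IsAdmissible cmin) (s : S) :
    I.cap * I.failProb π s ≤ I.value π s := by
  refine sub_nonpos.1 (le_of_lt_sum_trans (I := I) (π := π)
    (g := fun s => I.cap * I.failProb π s - I.value π s) (m := 0) (fun s => ?_) s)
  by_cases hs : s ∈ I.goal
  · left
    rw [failProb_of_mem_goal hs]
    linarith [value_nonneg (π := π) hI s]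
  have hW := congrFun (evalOp_value (π := π) hI) s
  rw [evalOp_apply, if_neg hs] at hW
  have hcap : 0 ≤ I.cap := (hI.terminal_nonneg s).trans (hI.terminal_le s)
  rcases min_choice (I.stageCost π s + ∑ s', I.trans π s s' * I.value π s') I.cap with h | h
  · right
    have hc := le_stageCost (π := π) hI s
    have h1 : ∑ s', I.trans π s s' * (I.cap * I.failProb π s' - I.value π s') =
        I.cap * I.failProb π s - ∑ s', I.trans π s s' * I.value π s' := by
      rw [failProb_of_notMem_goal hs, Finset.mul_sum, ← Finset.sum_sub_distrib]
      exact Finset.sum_congr rfl fun s' _ => by ring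
    rw [h1]
    linarith [hI.cmin_pos]
  · left
    have := mul_le_mul_of_nonneg_left (failProb_le_one (I := I) (π := π) s) hcap
    linarith

/-- From a state that can reach the goal, a level-decreasing step succeeds with probability at least
`b`, and at most `D` successes in a row suffice. The mean waiting time for such a run bounds the
cost beyond the penalty `cap * failProb` and the terminal cost. -/
theorem value_le_cap_mul_failProb_add (hI : I.IsAdmissible cmin) {b cmax B : ℝ} (hb : 0 < b)
    (htrans : ∀ s s', I.trans π s s' ≠ 0 → b ≤ I.trans π s s')
    (hcost : ∀ s a, I.cost s a ≤ cmax) (hB : ∀ s, I.terminal s ≤ B) (s : S) :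
    I.value π s ≤
      I.cap * I.failProb π s + (waitTime b I.transient.card * cmax + B) := by
  set D := I.transient.card with hD
  have hstage := stageCost_le (π := π) hcost
  have hcmax : 0 < cmax := hI.cmin_pos.trans_le ((le_stageCost (π := π) hI s).trans (hstage s))
  have hB0 : 0 ≤ B := (hI.terminal_nonneg s).trans (hB s)
  -- A supersolution: at level `l` the waiting term is the sum of `b⁻ⁱ` over `D - l < i ≤ D`, as if
  -- every failed step reset the level to `D`. Where the goal is unreachable, the cap itself is
  -- taken.
  set y : S → ℝ := fun s => if s ∈ I.goal then I.terminal s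
    else if I.reachProb π s = 0 then I.cap
    else I.cap * I.failProb π s +
      ((waitTime b D - waitTime b (D - I.level π s)) * cmax + B) with hy
  have hy_le : ∀ s, y s ≤ I.cap * I.failProb π s + (waitTime b D * cmax + B) := by
    intro s
    have h0 := mul_nonneg (waitTime_nonneg hb D) hcmax.le
    simp only [hy]
    split_ifs with h1 h2
    · rw [failProb_of_mem_goal h1]
      linarith [hB s]
    · rw [failProb, h2]
      linarith
    · have := mul_nonneg (waitTime_nonneg hb (D - I.level π s)) hcmax.le
      linarith
  have hcap : ∀ s, 0 ≤ I.cap := fun s => (hI.terminal_nonneg s).trans (hI.terminal_le s)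
  have hy_level : ∀ s, I.reachProb π s ≠ 0 → y s ≤ I.cap *
      I.failProb π s + ((waitTime b D - waitTime b (D - I.level π s)) * cmax + B) := by
    intro s hr
    simp only [hy]
    split_ifs with h1
    · rw [failProb_of_mem_goal h1, level_of_mem_goal h1]
      simp [hB s]
    · exact le_rfl
  have hreach : ∀ s, (∃ j, 0 < I.hitBy π j s) → I.reachProb π s ≠ 0 := by
    rintro s h
    induction hk : I.level π s generalizing s with
    | zero =>
      by_cases hs : s ∈ I.goal
      · rw [reachProb_of_mem_goal hs]; exact one_ne_zero
      · obtain ⟨s', -, -, h2⟩ := exists_level_eq_succ hs h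
        omega
    | succ k ih =>
      have hs : s ∉ I.goal := fun hs => by rw [level_of_mem_goal hs] at hk; omega
      obtain ⟨s', h1, h2, h3⟩ := exists_level_eq_succ hs h
      rw [reachProb_of_notMem_goal hs]
      refine (Finset.sum_pos' (fun t _ => mul_nonneg (trans_nonneg s t) (reachProb_nonneg t))
        ⟨s', Finset.mem_univ s', ?_⟩).ne'
      exact mul_pos ((trans_nonneg s s').lt_of_ne' h1)
        ((reachProb_nonneg s').lt_of_ne' (ih s' h2 (by omega)))
  refine (value_le_of_evalOp_le (y := y) (fun s => ?_) (fun s => ?_) s).trans (hy_le s)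
  · by_cases h1 : s ∈ I.goal
    · simp only [hy, if_pos h1]; exact le_rfl
    · rw [terminal_of_notMem_goal h1]
      simp only [hy, if_neg h1]
      split_ifs with h2
      · exact hcap s
      · have h3 := mul_nonneg (hcap s) (failProb_nonneg (I := I) (π := π) s)
        have h4 := mul_nonneg (sub_nonneg.2 (waitTime_mono hb (Nat.sub_le D (I.level π s))))
          hcmax.le
        linarith
  · rw [evalOp_apply]
    by_cases h1 : s ∈ I.goal
    · simp only [hy, if_pos h1]; exact le_rfl
    by_cases h2 : I.reachProb π s = 0
    · simp only [hy, if_neg h1, if_pos h2]; exact min_le_right _ _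
    rw [if_neg h1]
    refine (min_le_left _ _).trans ?_
    have hys : y s = I.cap * I.failProb π s +
      ((waitTime b D - waitTime b (D - I.level π s)) * cmax + B) := by
      simp only [hy, if_neg h1, if_neg h2]
    have hpos := exists_hitBy_pos ((reachProb_nonneg s).lt_of_ne' h2)
    obtain ⟨t, ht1, ht2, ht3⟩ := exists_level_eq_succ h1 hpos
    have hlD := level_le_card hpos
    set w := waitTime b (D - I.level π t) with hw
    have hwD : b * w = 1 + waitTime b (D - I.level π s) := by
      rw [hw, ← mul_waitTime_succ hb]
      congr 2
      omega
    -- Every successor gets the worst-case bound `hy_le`; only `t`, one level lower, is credited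
    -- with `w * cmax`. By `hwD` this credit pays for one stage cost and for the credit already
    -- granted at `s`.
    have key : ∑ s', I.trans π s s' * y s' ≤
        ∑ s', I.trans π s s' * (I.cap * I.failProb π s' + (waitTime b D * cmax + B)) -
          I.trans π s t * (w * cmax) := by
      rw [le_sub_iff_add_le, ← Finset.add_sum_erase _ _ (Finset.mem_univ t),
        ← Finset.add_sum_erase (a := t) _ _ (Finset.mem_univ t), add_right_comm, ← mul_add]
      refine add_le_add (mul_le_mul_of_nonneg_left ?_ (trans_nonneg s t))
        (Finset.sum_le_sum fun s' _ => mul_le_mul_of_nonneg_left (hy_le s') (trans_nonneg s s'))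
      linarith [hy_level t (hreach t ht2)]
    have h5 : ∀ E, ∑ s', I.trans π s s' * (I.cap * I.failProb π s' + E) =
        I.cap * I.failProb π s + E := by
      intro E
      simp_rw [mul_add (I.trans π s _), Finset.sum_add_distrib]
      rw [failProb_of_notMem_goal h1, sum_trans_mul_const, Finset.mul_sum]
      congr 1
      exact Finset.sum_congr rfl fun s' _ => by ring
    have h6 : b * (w * cmax) ≤ I.trans π s t * (w * cmax) :=
      mul_le_mul_of_nonneg_right (htrans s t ht1)
        (mul_nonneg (waitTime_nonneg hb _) hcmax.le)
    have h7 : b * (w * cmax) = (1 + waitTime b (D - I.level π s)) * cmax := by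
      rw [← mul_assoc, hwD]
    rw [hys]
    linarith [hstage s, h5 (waitTime b D * cmax + B)]

/-! ### Existence of reach-optimal policies -/

theorem exists_pos_le_trans (I : TransientProblem S A) (π : S → PMF A) :
    ∃ b, 0 < b ∧ ∀ s s', I.trans π s s' ≠ 0 → b ≤ I.trans π s s' := by
  rcases (Finset.univ.filter fun p : S × S => I.trans π p.1 p.2 ≠ 0).eq_empty_or_nonempty with h | h
  · refine ⟨1, one_pos, fun s s' hs => absurd ?_ (Finset.notMem_empty (s, s'))⟩
    exact h ▸ Finset.mem_filter.2 ⟨Finset.mem_univ _, hs⟩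
  · obtain ⟨p, hp, hmin⟩ := Finset.exists_min_image _ (fun p : S × S => I.trans π p.1 p.2) h
    refine ⟨I.trans π p.1 p.2, (trans_nonneg _ _).lt_of_ne' (Finset.mem_filter.1 hp).2, ?_⟩
    exact fun s s' hs => hmin (s, s') (Finset.mem_filter.2 ⟨Finset.mem_univ _, hs⟩)

/-- The problem with the same dynamics and target in which each step costs `η` and failing to
reach the target costs `1`. -/
def failureProblem (I : TransientProblem S A) (η : ℝ) : TransientProblem S A :=
  { I with cost := fun _ _ => η, gain := 0, lam := 0, Vbar := 1, epsPhi := 1 }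

theorem failureProblem_cap (η : ℝ) : (I.failureProblem η).cap = 1 := div_one 1

theorem failureProblem_terminal (η : ℝ) (s : S) : (I.failureProblem η).terminal s = 0 := by
  simp [terminal, failureProblem]

theorem failureProblem_isAdmissible {η : ℝ} (hη : 0 < η) :
    (I.failureProblem η).IsAdmissible η where
  cmin_pos := hη
  cmin_le _ _ := le_rfl
  terminal_nonneg s := (failureProblem_terminal η s).ge
  terminal_le s := by rw [failureProblem_terminal, failureProblem_cap]; exact zero_le_one

/-- With step cost `η` and failure cost `1`, the value lies between `failProb` and `failProb` plus a
constant times `η`. Cost-optimality therefore becomes reach-optimality as `η` tends to `0`. -/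
theorem exists_isReachOptimal [Nonempty A] (I : TransientProblem S A) :
    ∃ f : S → A, I.IsReachOptimal (detPolicy f) := by
  have hpos : ∀ m : ℕ, (0 : ℝ) < 1 / ((m : ℝ) + 1) := fun m => Nat.one_div_pos_of_nat
  choose F hF using fun m : ℕ => exists_isCostOptimal (failureProblem_isAdmissible (I := I) (hpos m))
  -- There are finitely many deterministic policies, so one is cost-optimal for infinitely many of
  -- the step costs `1 / (m + 1)`.
  obtain ⟨f, hf⟩ := Finite.exists_infinite_fiber F
  have hfreq : ∃ᶠ m in atTop, F m = f :=
    Nat.frequently_atTop_iff_infinite.2 (Set.infinite_coe_iff.1 hf)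
  refine ⟨f, fun π s => ?_⟩
  obtain ⟨b, hb, hbt⟩ := exists_pos_le_trans I π
  have hlim : Tendsto (fun m : ℕ => I.failProb π s +
      waitTime b I.transient.card * (1 / ((m : ℝ) + 1))) atTop (𝓝 (I.failProb π s)) := by
    simpa using (tendsto_one_div_add_atTop_nhds_zero_nat (𝕜 := ℝ)).const_mul
      (waitTime b I.transient.card) |>.const_add (I.failProb π s)
  have h : I.failProb (detPolicy f) s ≤ I.failProb π s := by
    refine ge_of_tendsto_of_frequently hlim (hfreq.mono fun m hm => ?_)
    have hadm := failureProblem_isAdmissible (I := I) (hpos m)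
    have h1 := cap_mul_failProb_le_value (π := detPolicy f) hadm s
    have h2 := hF m π s
    have h3 := value_le_cap_mul_failProb_add (π := π) hadm hb hbt (fun _ _ => le_rfl)
      (fun s => (failureProblem_terminal (I := I) (1 / ((m : ℝ) + 1)) s).le) s
    rw [hm] at h2
    rw [failureProblem_cap, one_mul] at h1 h3
    rw [add_zero] at h3
    exact h1.trans (h2.trans h3)
  exact (sub_le_sub_iff_left 1).1 h

end Reach

end TransientProblem

/-! ### An empirical Bernstein inequality for Bernoulli frequencies -/

/-- A quadratic lower bound on the binary relative entropy, with the variance taken at its first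
argument. -/
theorem sq_div_le_binary_klDiv {q p : ℝ} (hq : 0 < q) (hqp : q < p) (hp : p < 1) :
    (p - q) ^ 2 / (2 * (q * (1 - q) + (p - q))) ≤
      q * Real.log (q / p) + (1 - q) * Real.log ((1 - q) / (1 - p)) := by
  have hq1 : 0 < 1 - q := by linarith
  have hv : 0 < q * (1 - q) := mul_pos hq hq1
  set f : ℝ → ℝ := fun t => q * (Real.log q - Real.log t) +
    (1 - q) * (Real.log (1 - q) - Real.log (1 - t)) -
      (t - q) ^ 2 / (2 * (q * (1 - q) + (t - q))) with hf
  have hder : ∀ t ∈ Set.Icc q p, HasDerivAt f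
      (q * (0 - t⁻¹) + (1 - q) * (0 - (-1) / (1 - t)) -
        ((2 * (t - q)) * (2 * (q * (1 - q) + (t - q))) - (t - q) ^ 2 * 2) /
          (2 * (q * (1 - q) + (t - q))) ^ 2) t := by
    intro t ht
    have ht0 : t ≠ 0 := (hq.trans_le ht.1).ne'
    have ht1 : 1 - t ≠ 0 := by linarith [ht.2]
    have hd : 2 * (q * (1 - q) + (t - q)) ≠ 0 := by
      have := ht.1
      nlinarith
    have h1 := ((hasDerivAt_const t (Real.log q)).sub (Real.hasDerivAt_log ht0)).const_mul q
    have h2 := ((hasDerivAt_const t (Real.log (1 - q))).sub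
      (((hasDerivAt_id t).const_sub 1).log ht1)).const_mul (1 - q)
    have h3 : HasDerivAt (fun t => (t - q) ^ 2) (2 * (t - q)) t := by
      simpa using ((hasDerivAt_id t).sub_const q).fun_pow 2
    have h4 : HasDerivAt (fun t => 2 * (q * (1 - q) + (t - q))) 2 t := by
      simpa using (((hasDerivAt_id t).sub_const q).const_add (q * (1 - q))).const_mul 2
    exact (h1.add h2).sub (h3.div h4 hd)
  have hmono : MonotoneOn f (Set.Icc q p) := by
    refine monotoneOn_of_deriv_nonneg (convex_Icc q p)
      (fun t ht => (hder t ht).continuousAt.continuousWithinAt) (fun t ht => ?_) (fun t ht => ?_)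
    · exact (hder t (interior_subset ht)).differentiableAt.differentiableWithinAt
    · have ht' := interior_subset ht
      rw [(hder t ht').deriv]
      have ht0 : 0 < t := hq.trans_le ht'.1
      have ht1 : 0 < 1 - t := by linarith [ht'.2]
      obtain ⟨d, hd0, rfl⟩ : ∃ d, 0 ≤ d ∧ t = q + d := ⟨t - q, by linarith [ht'.1], by ring⟩
      have e1 : q * (0 - (q + d)⁻¹) + (1 - q) * (0 - (-1) / (1 - (q + d))) =
          d / ((q + d) * (1 - (q + d))) := by
        field_simp
        ring
      have e2 : ((2 * (q + d - q)) * (2 * (q * (1 - q) + (q + d - q))) - (q + d - q) ^ 2 * 2) /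
          (2 * (q * (1 - q) + (q + d - q))) ^ 2 =
          d * (q * (1 - q) + d / 2) / (q * (1 - q) + d) ^ 2 := by
        have : q * (1 - q) + d ≠ 0 := by positivity
        rw [add_sub_cancel_left]
        field_simp
        ring
      rw [e1, e2, sub_nonneg]
      calc d * (q * (1 - q) + d / 2) / (q * (1 - q) + d) ^ 2
          ≤ d * (q * (1 - q) + d) / (q * (1 - q) + d) ^ 2 := by
            gcongr
            linarith
        _ = d / (q * (1 - q) + d) := by
            have : q * (1 - q) + d ≠ 0 := by positivity
            field_simp
        -- The variance at `t = q + d` exceeds that at `q` by at most `d`, since `t(1-t) - q(1-q) =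
        -- d(1 - 2q - d)`.
        _ ≤ d / ((q + d) * (1 - (q + d))) := by
            refine div_le_div_of_nonneg_left hd0 (mul_pos ht0 ht1) ?_
            nlinarith [mul_nonneg hd0 hq.le, sq_nonneg d]
  have h := hmono ⟨le_rfl, hqp.le⟩ ⟨hqp.le, le_rfl⟩ hqp.le
  have hfq : f q = 0 := by simp [hf]
  rw [hfq] at h
  rw [Real.log_div hq.ne' (hq.trans hqp).ne', Real.log_div hq1.ne' (by linarith)]
  simp only [hf] at h
  linarith

section Bernoulli

variable {S : Type u} {Ω : Type w} [MeasurableSpace S] [MeasurableSpace Ω]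

/-- The number of visits of the first `n` samples to `B`. -/
def visitCount (X : ℕ → Ω → S) (B : Set S) (n : ℕ) (ω : Ω) : ℝ :=
  ∑ j ∈ Finset.range n, B.indicator (fun _ => (1 : ℝ)) (X j ω)

theorem visitCount_eq_card (X : ℕ → Ω → S) (B : Set S) [DecidablePred (· ∈ B)] (n : ℕ) (ω : Ω) :
    visitCount X B n ω = ((Finset.range n).filter fun j => X j ω ∈ B).card := by
  rw [Finset.card_filter, Nat.cast_sum, visitCount]
  refine Finset.sum_congr rfl fun j _ => ?_
  rw [Set.indicator_apply]
  split_ifs <;> simp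

theorem visitCount_compl (X : ℕ → Ω → S) (B : Set S) (n : ℕ) (ω : Ω) :
    visitCount X Bᶜ n ω = n - visitCount X B n ω := by
  rw [eq_sub_iff_add_eq, visitCount, visitCount, ← Finset.sum_add_distrib]
  simp_rw [Set.indicator_compl_add_self_apply]
  simp

variable {μ : Measure Ω} [IsProbabilityMeasure μ] {ν : Measure S} [IsProbabilityMeasure ν]
  {X : ℕ → Ω → S} {B : Set S}

theorem mgf_indicator (hX : Measurable (X 0)) (hlaw : μ.map (X 0) = ν)
    (hB : MeasurableSet B) (t : ℝ) :
    mgf (fun ω => B.indicator (fun _ => (1 : ℝ)) (X 0 ω)) μ t =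
      1 - ν.real B + ν.real B * Real.exp t := by
  have h : (fun ω => Real.exp (t * B.indicator (fun _ => (1 : ℝ)) (X 0 ω))) =
      fun ω => 1 + (X 0 ⁻¹' B).indicator (fun _ => Real.exp t - 1) ω := by
    funext ω
    by_cases hω : X 0 ω ∈ B
    · rw [Set.indicator_of_mem hω, Set.indicator_of_mem (by exact hω)]
      simp
    · rw [Set.indicator_of_notMem hω, Set.indicator_of_notMem (by exact hω)]
      simp
  have hm : MeasurableSet (X 0 ⁻¹' B) := hX hB
  rw [mgf, h, integral_add (integrable_const _) ((integrable_const _).indicator hm),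
    integral_indicator hm, setIntegral_const, integral_const]
  have : μ.real (X 0 ⁻¹' B) = ν.real B := by
    rw [← hlaw, measureReal_def, measureReal_def, Measure.map_apply hX hB]
  rw [this]
  simp
  ring

theorem visitCount_chernoff (hX : ∀ j, Measurable (X j)) (hlaw : ∀ j, μ.map (X j) = ν)
    (hind : iIndepFun X μ) (hB : MeasurableSet B) (n : ℕ) (a : ℝ) {t : ℝ} (ht : t ≤ 0) :
    μ.real {ω | visitCount X B n ω ≤ a} ≤
      Real.exp (-t * a) * (1 - ν.real B + ν.real B * Real.exp t) ^ n := by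
  have hg : Measurable (B.indicator fun _ => (1 : ℝ)) := measurable_const.indicator hB
  set Y : ℕ → Ω → ℝ := fun j ω => B.indicator (fun _ => (1 : ℝ)) (X j ω) with hY
  have hYm : ∀ j, Measurable (Y j) := fun j => hg.comp (hX j)
  have hYind : iIndepFun Y μ := hind.comp (fun _ => B.indicator fun _ => (1 : ℝ)) fun _ => hg
  have hsum : visitCount X B n = ∑ j ∈ Finset.range n, Y j := by
    funext ω
    rw [Finset.sum_apply, visitCount]
  have hmeas : Measurable (visitCount X B n) := Finset.measurable_sum _ fun j _ => hYm j
  have h0 : ∀ ω, 0 ≤ visitCount X B n ω := fun ω =>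
    Finset.sum_nonneg fun j _ => Set.indicator_nonneg (fun _ _ => zero_le_one) _
  have hint : Integrable (fun ω => Real.exp (t * visitCount X B n ω)) μ := by
    refine Integrable.of_bound (C := 1) (by fun_prop) (Eventually.of_forall fun ω => ?_)
    rw [Real.norm_of_nonneg (Real.exp_nonneg _), Real.exp_le_one_iff]
    exact mul_nonpos_of_nonpos_of_nonneg ht (h0 ω)
  refine (measure_le_le_exp_mul_mgf a ht hint).trans_eq ?_
  rw [hsum, hYind.mgf_sum hYm, Finset.prod_congr rfl
    fun j _ => mgf_indicator (X := fun _ => X j) (hX j) (hlaw j) hB t, Finset.prod_const,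
    Finset.card_range]

/-- Chernoff's bound with the optimal tilt gives the exponent `n` times the relative entropy, which
`sq_div_le_binary_klDiv` bounds below by `n * x`. The boundary cases `q = 0` and `p = 1`, where the
optimal tilt degenerates, use explicit tilts instead. -/
theorem visitCount_lower_tail (hX : ∀ j, Measurable (X j)) (hlaw : ∀ j, μ.map (X j) = ν)
    (hind : iIndepFun X μ) (hB : MeasurableSet B) {n : ℕ} (hn : 0 < n) {q x : ℝ}
    (hq : 0 ≤ q) (hx : 0 ≤ x)
    (h : Real.sqrt (2 * q * (1 - q) * x) + 7 / 3 * x < ν.real B - q) :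
    μ.real {ω | visitCount X B n ω ≤ n * q} ≤ Real.exp (-(n * x)) := by
  set p := ν.real B with hp
  have hp1 : p ≤ 1 := measureReal_le_one
  have hs := Real.sqrt_nonneg (2 * q * (1 - q) * x)
  have hqp : q < p := by linarith
  have hch := fun t ht => visitCount_chernoff hX hlaw hind hB n (n * q) (t := t) ht
  have hn0 : (0 : ℝ) < n := Nat.cast_pos.2 hn
  rw [← hp] at hch
  rcases hq.eq_or_lt with rfl | hq0
  · refine (hch (-Real.log 2) (by linarith [Real.log_pos one_lt_two])).trans ?_
    rw [Real.exp_neg (Real.log 2), Real.exp_log two_pos, mul_zero, mul_zero, Real.exp_zero, one_mul]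
    have h1 : 1 - p + p * 2⁻¹ ≤ Real.exp (-(p / 2)) := by
      linarith [Real.add_one_le_exp (-(p / 2))]
    calc (1 - p + p * 2⁻¹) ^ n ≤ Real.exp (-(p / 2)) ^ n :=
          pow_le_pow_left₀ (by linarith) h1 n
      _ = Real.exp (n * (-(p / 2))) := (Real.exp_nat_mul _ n).symm
      _ ≤ _ := by
          rw [Real.exp_le_exp, ← mul_neg]
          refine mul_le_mul_of_nonneg_left ?_ hn0.le
          rw [mul_zero, zero_mul, zero_mul, Real.sqrt_zero] at h
          linarith
  rcases hp1.eq_or_lt with hp1 | hp1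
  · have hq1 : 0 < 1 - q := by linarith
    refine (hch (-(x / (1 - q))) (neg_nonpos.2 (by positivity))).trans_eq ?_
    rw [hp1, sub_self, zero_add, one_mul, ← Real.exp_nat_mul, ← Real.exp_add]
    congr 1
    field_simp
    ring
  · have hp0 : 0 < p := hq0.trans hqp
    have hq1 : 0 < 1 - q := by linarith
    have hp1' : 0 < 1 - p := by linarith
    set r := q * (1 - p) / (p * (1 - q)) with hr
    have hr0 : 0 < r := by positivity
    have hr1 : r ≤ 1 := by
      rw [hr, div_le_one (by positivity)]
      nlinarith
    refine (hch (Real.log r) (Real.log_nonpos hr0.le hr1)).trans ?_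
    have e1 : 1 - p + p * r = (1 - p) / (1 - q) := by
      rw [hr]
      field_simp
      ring
    rw [Real.exp_log hr0, e1, ← Real.exp_log (div_pos hp1' hq1), ← Real.exp_nat_mul, ← Real.exp_add,
      Real.exp_le_exp]
    have e2 : Real.log r = Real.log (q / p) + Real.log ((1 - p) / (1 - q)) := by
      rw [← Real.log_mul (by positivity) (by positivity), hr, div_mul_div_comm]
    have e3 : Real.log ((1 - p) / (1 - q)) = -Real.log ((1 - q) / (1 - p)) := by
      rw [← Real.log_inv, inv_div]
    have hkl := sq_div_le_binary_klDiv hq0 hqp hp1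
    have hx2 : x ≤ (p - q) ^ 2 / (2 * (q * (1 - q) + (p - q))) := by
      rw [le_div_iff₀ (by nlinarith)]
      have hsq := Real.sq_sqrt (show 0 ≤ 2 * q * (1 - q) * x by positivity)
      set a := Real.sqrt (2 * q * (1 - q) * x)
      -- With `d = p - q`, the hypothesis gives `d ≥ a + 2x`, so `d(d - 2x) ≥ a² = 2q(1-q)x`, which
      -- rearranges to the claim; the coefficient `2` would do in place of `7/3` here.
      have h1 : (a + 2 * x) * a ≤ (p - q) * (p - q - 2 * x) :=
        mul_le_mul (by linarith) (by linarith) hs (by linarith)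
      nlinarith [mul_nonneg hx hs]
    have h3 := mul_le_mul_of_nonneg_left (hx2.trans hkl) hn0.le
    rw [e2, e3]
    linarith

/-- The radius depends on the random frequency, but no union over its values is needed: the bad
event lies in `{count ≤ k}` for the largest bad count `k`, and the lower tail bound applies at that
`k` because it is itself bad. -/
theorem visitCount_deviation (hX : ∀ j, Measurable (X j)) (hlaw : ∀ j, μ.map (X j) = ν)
    (hind : iIndepFun X μ) (hB : MeasurableSet B) {n : ℕ} (hn : 0 < n) {x : ℝ} (hx : 0 ≤ x) :
    μ.real {ω | Real.sqrt (2 * (visitCount X B n ω / n) * (1 - visitCount X B n ω / n) * x) +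
      7 / 3 * x < ν.real B - visitCount X B n ω / n} ≤ Real.exp (-(n * x)) := by
  classical
  have hn0 : (0 : ℝ) < n := Nat.cast_pos.2 hn
  set bad : Finset ℕ := (Finset.range (n + 1)).filter fun k =>
    Real.sqrt (2 * ((k : ℝ) / n) * (1 - (k : ℝ) / n) * x) + 7 / 3 * x < ν.real B - (k : ℝ) / n
    with hbad
  have hmem : ∀ ω, Real.sqrt (2 * (visitCount X B n ω / n) * (1 - visitCount X B n ω / n) * x) +
      7 / 3 * x < ν.real B - visitCount X B n ω / n →
      ∃ k ∈ bad, visitCount X B n ω = k := by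
    intro ω hω
    rw [visitCount_eq_card] at hω ⊢
    refine ⟨_, Finset.mem_filter.2 ⟨Finset.mem_range_succ_iff.2 ?_, hω⟩, rfl⟩
    exact (Finset.card_filter_le _ _).trans_eq (Finset.card_range n)
  rcases bad.eq_empty_or_nonempty with h | h
  · refine (le_of_eq ?_).trans (Real.exp_nonneg _)
    rw [Set.eq_empty_of_forall_notMem (s := {ω | _}), measureReal_empty]
    intro ω hω
    obtain ⟨k, hk, -⟩ := hmem ω hω
    exact Finset.notMem_empty k (h ▸ hk)
  · have hmax := (Finset.mem_filter.1 (bad.max'_mem h)).2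
    refine (measureReal_mono fun ω hω => ?_).trans
      (visitCount_lower_tail hX hlaw hind hB hn (by positivity) hx hmax)
    obtain ⟨k, hk, hkω⟩ := hmem ω hω
    rw [Set.mem_ofPred_eq, hkω, mul_div_cancel₀ _ hn0.ne']
    exact Nat.cast_le.2 (bad.le_max' k hk)

theorem visitCount_abs_deviation (hX : ∀ j, Measurable (X j)) (hlaw : ∀ j, μ.map (X j) = ν)
    (hind : iIndepFun X μ) (hB : MeasurableSet B) {n : ℕ} (hn : 0 < n) {x : ℝ} (hx : 0 ≤ x) :
    μ.real {ω | Real.sqrt (2 * (visitCount X B n ω / n) * (1 - visitCount X B n ω / n) * x) +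
      7 / 3 * x < |ν.real B - visitCount X B n ω / n|} ≤ 2 * Real.exp (-(n * x)) := by
  have hn0 : (n : ℝ) ≠ 0 := Nat.cast_ne_zero.2 hn.ne'
  have h1 := visitCount_deviation hX hlaw hind hB hn hx
  -- The variance proxy is symmetric under `q ↦ 1 - q`, so the upper tail is the lower tail of the
  -- complement.
  have h2 := visitCount_deviation hX hlaw hind hB.compl hn hx
  rw [two_mul]
  refine ((measureReal_mono fun ω hω => ?_).trans (measureReal_union_le _ _)).trans
    (add_le_add h1 h2)
  rw [Set.mem_ofPred_eq] at hω
  rcases lt_abs.1 hω with h | h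
  · exact Or.inl h
  · right
    have e : visitCount X Bᶜ n ω / n = 1 - visitCount X B n ω / n := by
      rw [visitCount_compl, sub_div, div_self hn0]
    have e2 : ∀ y : ℝ, 2 * (1 - y) * (1 - (1 - y)) * x = 2 * y * (1 - y) * x := fun y => by ring
    rw [Set.mem_ofPred_eq, e, probReal_compl_eq_one_sub hB, e2]
    linarith

end Bernoulli

/-! ### Probability of the good event -/

namespace TransientProblem

variable {S : Type u} {A : Type v} [Fintype S] [DecidableEq S] [Fintype A]

theorem one_le_xi_arg [Nonempty S] [Nonempty A] {δ : ℝ} (hδ : 0 < δ) (hδ1 : δ < 1) {n : ℕ}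
    (hn : 1 ≤ n) :
    1 ≤ 4 * (n : ℝ) ^ 2 * (Fintype.card S : ℝ) ^ 2 * (Fintype.card A : ℝ) / δ := by
  have h1 : (1 : ℝ) ≤ n := Nat.one_le_cast.2 hn
  have h2 : (1 : ℝ) ≤ Fintype.card S := Nat.one_le_cast.2 Fintype.card_pos
  have h3 : (1 : ℝ) ≤ Fintype.card A := Nat.one_le_cast.2 Fintype.card_pos
  rw [one_le_div hδ]
  have h4 : (1 : ℝ) ≤ (n : ℝ) ^ 2 * (Fintype.card S : ℝ) ^ 2 * (Fintype.card A : ℝ) :=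
    one_le_mul_of_one_le_of_one_le
      (one_le_mul_of_one_le_of_one_le (one_le_pow₀ h1) (one_le_pow₀ h2)) h3
  nlinarith

theorem xi_nonneg [Nonempty S] [Nonempty A] {δ : ℝ} (hδ : 0 < δ) (hδ1 : δ < 1) {n : ℕ}
    (hn : 1 ≤ n) : 0 ≤ xi S A δ n :=
  div_nonneg (Real.log_nonneg (one_le_xi_arg hδ hδ1 hn)) (sub_nonneg.2 (Nat.one_le_cast.2 hn))

variable [Nonempty S] [MeasurableSpace S] [MeasurableSingletonClass S] [Nonempty A]
  {Ω : Type w} [MeasurableSpace Ω] {μ : Measure Ω} [IsProbabilityMeasure μ]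
  {I : TransientProblem S A} {X : S → A → ℕ → Ω → S} {δ : ℝ}

theorem measureReal_deviation_le (hδ : 0 < δ) (hδ1 : δ < 1)
    (hX : ∀ s a j, Measurable (X s a j)) (hlaw : ∀ s a j, μ.map (X s a j) = (I.P s a).toMeasure)
    (hind : ∀ s a, iIndepFun (fun j => X s a j) μ) {n : ℕ} (hn : 1 < n) (s : S) (a : A) (s' : S) :
    μ.real {ω | radius S A δ n (empirical X n ω s a s') <
      |(I.P s a s').toReal - empirical X n ω s a s'|} ≤
      δ / (2 * (Fintype.card S : ℝ) ^ 2 * (Fintype.card A : ℝ)) * (1 / (n : ℝ) ^ 2) := by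
  have hn1 : (1 : ℝ) < n := Nat.one_lt_cast.2 hn
  have hx := xi_nonneg (S := S) (A := A) hδ hδ1 hn.le
  have h := visitCount_abs_deviation (hX s a) (hlaw s a) (hind s a)
    (measurableSet_singleton s') (zero_lt_one.trans hn) hx
  have e : ∀ ω, visitCount (X s a) {s'} n ω / n = empirical X n ω s a s' := fun ω => by
    rw [visitCount_eq_card, empirical]
    rfl
  simp_rw [e] at h
  have e2 : (I.P s a).toMeasure.real {s'} = (I.P s a s').toReal := by
    rw [measureReal_def, PMF.toMeasure_apply_singleton _ _ (measurableSet_singleton s')]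
  rw [e2] at h
  refine h.trans ?_
  have hpos := zero_lt_one.trans_le (one_le_xi_arg (S := S) (A := A) hδ hδ1 hn.le)
  have h3 : Real.log (4 * (n : ℝ) ^ 2 * (Fintype.card S : ℝ) ^ 2 * (Fintype.card A : ℝ) / δ) ≤
      n * xi S A δ n := by
    have : (n - 1 : ℝ) * xi S A δ n = _ := mul_div_cancel₀ _ (by linarith)
    rw [← this]
    nlinarith
  calc 2 * Real.exp (-(n * xi S A δ n)) ≤ 2 * Real.exp (-Real.log
        (4 * (n : ℝ) ^ 2 * (Fintype.card S : ℝ) ^ 2 * (Fintype.card A : ℝ) / δ)) := by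
        gcongr
    _ = _ := by
        rw [Real.exp_neg, Real.exp_log hpos]
        have : (Fintype.card S : ℝ) ≠ 0 := Nat.cast_ne_zero.2 Fintype.card_ne_zero
        have : (Fintype.card A : ℝ) ≠ 0 := Nat.cast_ne_zero.2 Fintype.card_ne_zero
        field_simp
        ring

theorem one_sub_le_measureReal_goodEvent (hδ : 0 < δ) (hδ1 : δ < 1)
    (hX : ∀ s a j, Measurable (X s a j)) (hlaw : ∀ s a j, μ.map (X s a j) = (I.P s a).toMeasure)
    (hind : ∀ s a, iIndepFun (fun j => X s a j) μ) :
    1 - δ ≤ μ.real (I.goodEvent X δ) := by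
  set C := δ / (2 * (Fintype.card S : ℝ) ^ 2 * (Fintype.card A : ℝ)) with hC
  have hC0 : 0 ≤ C := by positivity
  set bad : ℕ → S × A × S → Set Ω := fun n i => {ω | 1 < n ∧
    radius S A δ n (empirical X n ω i.1 i.2.1 i.2.2) <
      |(I.P i.1 i.2.1 i.2.2).toReal - empirical X n ω i.1 i.2.1 i.2.2|} with hbad
  have hle : ∀ n i, μ (bad n i) ≤ ENNReal.ofReal (C * (1 / (n : ℝ) ^ 2)) := by
    intro n i
    by_cases hn : 1 < n
    · rw [← ofReal_measureReal]
      refine ENNReal.ofReal_le_ofReal ((measureReal_mono fun ω hω => hω.2).trans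
        (measureReal_deviation_le hδ hδ1 hX hlaw hind hn i.1 i.2.1 i.2.2))
    · rw [Set.eq_empty_of_forall_notMem (s := bad n i) fun ω hω => hn hω.1, measure_empty]
      exact zero_le
  -- The term at `n = 0` is `0` by the division convention. After the union over triples the total
  -- is `δ π² / 12 ≤ δ`.
  have hsum := hasSum_zeta_two.mul_left C
  have hcompl : (I.goodEvent X δ)ᶜ ⊆ ⋃ n, ⋃ i, bad n i := by
    intro ω hω
    rw [Set.mem_compl_iff, goodEvent, Set.mem_ofPred_eq] at hω
    push Not at hω
    obtain ⟨s, a, s', n, hn, h⟩ := hω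
    exact Set.mem_iUnion.2 ⟨n, Set.mem_iUnion.2 ⟨(s, a, s'), hn, h⟩⟩
  have hμ : μ (I.goodEvent X δ)ᶜ ≤ ENNReal.ofReal δ := by
    calc μ (I.goodEvent X δ)ᶜ ≤ ∑' n, ∑ i, μ (bad n i) :=
          (measure_mono hcompl).trans ((measure_iUnion_le _).trans
            (ENNReal.tsum_le_tsum fun n => measure_iUnion_fintype_le _ _))
      _ ≤ ∑' n : ℕ, ENNReal.ofReal
            (Fintype.card (S × A × S) * (C * (1 / (n : ℝ) ^ 2))) := by
          refine ENNReal.tsum_le_tsum fun n => (Finset.sum_le_sum fun i _ => hle n i).trans_eq ?_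
          rw [Finset.sum_const, nsmul_eq_mul, ENNReal.ofReal_mul (Nat.cast_nonneg _),
            ENNReal.ofReal_natCast, Finset.card_univ]
      _ = ENNReal.ofReal (Fintype.card (S × A × S) * (C * (Real.pi ^ 2 / 6))) := by
          rw [← (hsum.mul_left _).tsum_eq, ENNReal.ofReal_tsum_of_nonneg
            (fun n => by positivity) (hsum.mul_left _).summable]
      _ ≤ ENNReal.ofReal δ := by
          refine ENNReal.ofReal_le_ofReal ?_
          have h1 : (Fintype.card S : ℝ) ≠ 0 := Nat.cast_ne_zero.2 Fintype.card_ne_zero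
          have h2 : (Fintype.card A : ℝ) ≠ 0 := Nat.cast_ne_zero.2 Fintype.card_ne_zero
          have e : (Fintype.card (S × A × S) : ℝ) * (C * (Real.pi ^ 2 / 6)) =
              δ * (Real.pi ^ 2 / 12) := by
            rw [hC, Fintype.card_prod, Fintype.card_prod]
            push_cast
            field_simp
            ring
          rw [e]
          have hpi : Real.pi ^ 2 / 12 ≤ 1 := by nlinarith [Real.pi_lt_d2, Real.pi_pos]
          exact mul_le_of_le_one_right hδ.le hpi
  have hμ' : μ.real (I.goodEvent X δ)ᶜ ≤ δ :=
    ENNReal.toReal_le_of_le_ofReal hδ.le hμ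
  have h1 : 1 ≤ μ.real (I.goodEvent X δ) + μ.real (I.goodEvent X δ)ᶜ := by
    rw [← probReal_univ (μ := μ), ← Set.union_compl_self (I.goodEvent X δ)]
    exact measureReal_union_le _ _
  linarith

end TransientProblem

/-! ### Optimistic value iteration -/

namespace TransientProblem

variable {S : Type u} {A : Type v} [Fintype S] [DecidableEq S] [Fintype A] [Nonempty A]
variable {I : TransientProblem S A} {cmin δ ρ β e : ℝ} {n : ℕ} {Phat : S → A → S → ℝ}

/-- The true transition probabilities are plausible, and no plausible distribution is more than `ρ`
below them in any coordinate. -/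
structure IsAccurate (I : TransientProblem S A) (δ : ℝ) (n : ℕ) (Phat : S → A → S → ℝ)
    (ρ : ℝ) : Prop where
  mem_plausible : ∀ s a, (fun s' => (I.P s a s').toReal) ∈ plausible A δ n (Phat s a)
  sub_le : ∀ s a, ∀ p ∈ plausible A δ n (Phat s a), ∀ s', (I.P s a s').toReal - p s' ≤ ρ

theorem bddBelow_plausible_image (δ : ℝ) (n : ℕ) (q x : S → ℝ) :
    BddBelow ((fun p : S → ℝ => ∑ s', p s' * x s') '' plausible A δ n q) := by
  refine ⟨-‖x‖, ?_⟩
  rintro _ ⟨p, hp, rfl⟩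
  calc -‖x‖ = ∑ s', p s' * -‖x‖ := by rw [← Finset.sum_mul, hp.1.2, one_mul]
    _ ≤ _ := Finset.sum_le_sum fun s' _ => mul_le_mul_of_nonneg_left
        (neg_le_of_abs_le (norm_le_pi_norm x s')) (hp.1.1 s')

theorem optimisticQ_le (hP : I.IsAccurate δ n Phat ρ) (x : S → ℝ) (s : S) (a : A) :
    I.optimisticQ δ n Phat x s a ≤ I.cost s a + ∑ s', (I.P s a s').toReal * x s' :=
  add_le_add le_rfl
    (csInf_le (bddBelow_plausible_image δ n _ x) ⟨_, hP.mem_plausible s a, rfl⟩)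

theorem optimisticQ_mono (hP : I.IsAccurate δ n Phat ρ) {x y : S → ℝ} (h : x ≤ y) (s : S) (a : A) :
    I.optimisticQ δ n Phat x s a ≤ I.optimisticQ δ n Phat y s a := by
  refine add_le_add le_rfl (le_csInf ⟨_, _, hP.mem_plausible s a, rfl⟩ ?_)
  rintro _ ⟨p, hp, rfl⟩
  exact (csInf_le (bddBelow_plausible_image δ n _ x) ⟨p, hp, rfl⟩).trans
    (Finset.sum_le_sum fun s' _ => mul_le_mul_of_nonneg_left (h s') (hp.1.1 s'))

theorem cost_le_optimisticQ (hP : I.IsAccurate δ n Phat ρ) {x : S → ℝ} (hx : 0 ≤ x)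
    (s : S) (a : A) : I.cost s a ≤ I.optimisticQ δ n Phat x s a := by
  refine le_add_of_nonneg_right (le_csInf ⟨_, _, hP.mem_plausible s a, rfl⟩ ?_)
  rintro _ ⟨p, hp, rfl⟩
  exact Finset.sum_nonneg fun s' _ => mul_nonneg (hp.1.1 s') (hx s')

theorem planOp_mono (hP : I.IsAccurate δ n Phat ρ) : Monotone (I.planOp δ n Phat) := by
  intro x y h s
  unfold planOp
  split_ifs
  · exact le_rfl
  · exact min_le_min (ciInf_mono (Set.finite_range _).bddBelow
      fun a => optimisticQ_mono hP h s a) le_rfl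

theorem planOp_le_evalOp (hP : I.IsAccurate δ n Phat ρ) (π : S → PMF A) (x : S → ℝ) :
    I.planOp δ n Phat x ≤ I.evalOp π x := by
  intro s
  unfold planOp evalOp
  split_ifs
  · exact le_rfl
  · refine min_le_min ?_ le_rfl
    calc _ = ∑ a, (π s a).toReal * ⨅ a, I.optimisticQ δ n Phat x s a := by
          rw [← Finset.sum_mul, PMF.sum_toReal_eq_one, one_mul]
      _ ≤ _ := Finset.sum_le_sum fun a _ => mul_le_mul_of_nonneg_left
          ((ciInf_le (Set.finite_range _).bddBelow a).trans (optimisticQ_le hP x s a))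
          ENNReal.toReal_nonneg

theorem terminal_le_planOp (hI : I.IsAdmissible cmin) (hP : I.IsAccurate δ n Phat ρ) :
    I.terminal ≤ I.planOp δ n Phat I.terminal := by
  intro s
  unfold planOp
  split_ifs with hs
  · exact le_rfl
  · rw [terminal_of_notMem_goal hs]
    refine le_min (le_ciInf fun a => ?_) ((hI.terminal_nonneg s).trans (hI.terminal_le s))
    exact (hI.cmin_pos.le.trans (hI.cmin_le s a)).trans
      (cost_le_optimisticQ hP hI.terminal_nonneg s a)

theorem viIter_succ (j : ℕ) :
    I.viIter δ n Phat (j + 1) = I.planOp δ n Phat (I.viIter δ n Phat j) :=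
  Function.iterate_succ_apply' _ _ _

theorem viIter_of_mem_goal {s : S} (hs : s ∈ I.goal) (j : ℕ) :
    I.viIter δ n Phat j s = I.terminal s := by
  cases j with
  | zero => rfl
  | succ j => rw [viIter_succ, planOp, if_pos hs]

theorem viIter_le_value (hI : I.IsAdmissible cmin) (hP : I.IsAccurate δ n Phat ρ)
    (π : S → PMF A) (j : ℕ) (s : S) : I.viIter δ n Phat j s ≤ I.value π s :=
  (iterate_le_iterate_of_le (planOp_mono hP) (fun _ => planOp_le_evalOp hP π _) j s).trans
    (iterate_le_value hI j s)

theorem viIter_le_cap (hI : I.IsAdmissible cmin) (hP : I.IsAccurate δ n Phat ρ) (j : ℕ) (s : S) :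
    I.viIter δ n Phat j s ≤ I.cap := by
  obtain ⟨a⟩ := ‹Nonempty A›
  exact (viIter_le_value hI hP (detPolicy fun _ => a) j s).trans (value_le_cap hI s)

theorem viIter_nonneg (hI : I.IsAdmissible cmin) (hP : I.IsAccurate δ n Phat ρ) (j : ℕ) (s : S) :
    0 ≤ I.viIter δ n Phat j s :=
  (hI.terminal_nonneg s).trans
    ((planOp_mono hP).monotone_iterate_of_le_map (terminal_le_planOp hI hP) (Nat.zero_le j) s)

theorem tendsto_viIter (hI : I.IsAdmissible cmin) (hP : I.IsAccurate δ n Phat ρ) :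
    ∃ x, Tendsto (I.viIter δ n Phat) atTop (𝓝 x) :=
  ⟨_, tendsto_iterate_iSup (planOp_mono hP) (terminal_le_planOp hI hP)
    (viIter_le_cap hI hP)⟩

theorem exists_isGreedy (I : TransientProblem S A) (δ : ℝ) (n : ℕ) (Phat : S → A → S → ℝ)
    (x : S → ℝ) : ∃ f, I.IsGreedy δ n Phat x f := by
  choose f hf using fun s => Finite.exists_min (I.optimisticQ δ n Phat x s)
  exact ⟨f, fun s _ a => hf s a⟩

theorem exists_isPlanOutput {epsPT : ℝ} {x : S → ℝ}
    (h : Tendsto (I.viIter δ n Phat) atTop (𝓝 x))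
    (he : 0 < cmin * epsPT * I.epsPhi / (4 * I.Vbar)) :
    ∃ f, I.IsPlanOutput δ cmin epsPT n Phat f := by
  have h1 : Tendsto (fun j => ‖I.viIter δ n Phat (j + 1) - I.viIter δ n Phat j‖) atTop (𝓝 0) := by
    simpa using (((tendsto_add_atTop_iff_nat 1).2 h).sub h).norm
  obtain ⟨j, hj⟩ := (h1.eventually (ge_mem_nhds he)).exists
  obtain ⟨f, hf⟩ := I.exists_isGreedy δ n Phat (I.viIter δ n Phat j)
  exact ⟨f, j, hj, hf⟩

/-- `x` raised by `t` on the transient states. -/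
def raise (I : TransientProblem S A) (t : ℝ) (x : S → ℝ) (s : S) : ℝ :=
  x s + if s ∈ I.goal then 0 else t

theorem le_raise {t : ℝ} (ht : 0 ≤ t) (x : S → ℝ) (s : S) : x s ≤ I.raise t x s := by
  unfold raise
  split_ifs <;> linarith

/-- Transient successors each lose at most `ρ * M`. A goal successor of positive probability loses
at most `ρ * M` too, but it is not raised, and the unused share of the raise, `P * (ρ * M / β) ≥ ρ *
M`, covers that loss. -/
theorem cost_add_le_optimisticQ (hP : I.IsAccurate δ n Phat ρ) (hρ : 0 ≤ ρ) (hβ : 0 < β)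
    (hPβ : ∀ s a s', I.P s a s' ≠ 0 → β ≤ (I.P s a s').toReal) {x : S → ℝ} (hx : 0 ≤ x) {M : ℝ}
    (hxM : ∀ s, x s ≤ M) (s : S) (a : A) :
    I.cost s a + ∑ s', (I.P s a s').toReal * I.raise (ρ * M / β) x s' ≤
      I.optimisticQ δ n Phat x s a + (ρ * M * I.transient.card + ρ * M / β) := by
  have hM : 0 ≤ M := (hx s).trans (hxM s)
  have hρM : 0 ≤ ρ * M := mul_nonneg hρ hM
  rw [optimisticQ, add_assoc, ← sub_le_iff_le_add', add_sub_cancel_left, ← sub_le_iff_le_add]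
  refine le_csInf ⟨_, _, hP.mem_plausible s a, rfl⟩ ?_
  rintro _ ⟨p, hp, rfl⟩
  rw [sub_le_iff_le_add]
  have hterm : ∀ s', (I.P s a s').toReal * I.raise (ρ * M / β) x s' ≤
      p s' * x s' + ((if s' ∈ I.transient then ρ * M else 0) +
        (I.P s a s').toReal * (ρ * M / β)) := by
    intro s'
    have hsub : ((I.P s a s').toReal - p s') * x s' ≤ ρ * M :=
      (mul_le_mul_of_nonneg_right (hP.sub_le s a p hp s') (hx s')).trans
        (mul_le_mul_of_nonneg_left (hxM s') hρ)
    unfold raise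
    by_cases hs' : s' ∈ I.goal
    · rw [if_pos hs', if_neg (fun h => mem_transient.1 h hs'), add_zero, zero_add]
      by_cases h0 : I.P s a s' = 0
      · rw [h0, ENNReal.toReal_zero, zero_mul, zero_mul, add_zero]
        exact mul_nonneg (hp.1.1 s') (hx s')
      · have h1 : ρ * M ≤ (I.P s a s').toReal * (ρ * M / β) := by
          rw [mul_div_assoc', le_div_iff₀ hβ, mul_comm]
          exact mul_le_mul_of_nonneg_right (hPβ s a s' h0) hρM
        linarith
    · rw [if_neg hs', if_pos (mem_transient.2 hs')]
      linarith
  refine (Finset.sum_le_sum fun s' _ => hterm s').trans_eq ?_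
  rw [Finset.sum_add_distrib, Finset.sum_add_distrib, ← Finset.sum_mul, PMF.sum_toReal_eq_one,
    one_mul, Finset.sum_ite_mem, Finset.univ_inter, Finset.sum_const, nsmul_eq_mul, mul_comm _ (ρ * M)]

/-! ### Quality of the planner's output -/

theorem viIter_succ_le_add {j : ℕ}
    (he : ‖I.viIter δ n Phat (j + 1) - I.viIter δ n Phat j‖ ≤ e) (s : S) :
    I.viIter δ n Phat (j + 1) s ≤ I.viIter δ n Phat j s + e := by
  have := (le_abs_self _).trans ((norm_le_pi_norm
    (I.viIter δ n Phat (j + 1) - I.viIter δ n Phat j) s).trans he)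
  rw [Pi.sub_apply] at this
  linarith

/-- Where the cap is inactive, the raised iterate satisfies the greedy policy's true Bellman
inequality up to the stopping residual and the transient error; the raise cancels between the two
sides. -/
theorem viIter_succ_eq_cap_or (hI : I.IsAdmissible cmin) (hP : I.IsAccurate δ n Phat ρ)
    (hρ : 0 ≤ ρ) (hβ : 0 < β) (hPβ : ∀ s a s', I.P s a s' ≠ 0 → β ≤ (I.P s a s').toReal)
    {j : ℕ} {f : S → A} (hf : I.IsGreedy δ n Phat (I.viIter δ n Phat j) f)
    (he : ‖I.viIter δ n Phat (j + 1) - I.viIter δ n Phat j‖ ≤ e) {s : S} (hs : s ∉ I.goal) :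
    I.viIter δ n Phat (j + 1) s = I.cap ∨
      I.stageCost (detPolicy f) s + ∑ s', I.trans (detPolicy f) s s' *
        I.raise (ρ * I.cap / β) (I.viIter δ n Phat j) s' ≤
      I.raise (ρ * I.cap / β) (I.viIter δ n Phat j) s + (e + ρ * I.cap * I.transient.card) := by
  have hres := viIter_succ_le_add he s
  have hsucc : I.viIter δ n Phat (j + 1) s =
      min (I.optimisticQ δ n Phat (I.viIter δ n Phat j) s (f s)) I.cap := by
    rw [viIter_succ, planOp, if_neg hs]
    congr 1
    exact le_antisymm (ciInf_le (Set.finite_range _).bddBelow _)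
      (le_ciInf fun a => hf s (mem_transient.2 hs) a)
  rcases min_choice (I.optimisticQ δ n Phat (I.viIter δ n Phat j) s (f s)) I.cap with h | h
  · right
    have h1 := cost_add_le_optimisticQ hP hρ hβ hPβ (viIter_nonneg hI hP j) (viIter_le_cap hI hP j)
      s (f s)
    have h2 : I.raise (ρ * I.cap / β) (I.viIter δ n Phat j) s =
      I.viIter δ n Phat j s + ρ * I.cap / β := by rw [raise, if_neg hs]
    simp_rw [stageCost_detPolicy, trans_detPolicy]
    linarith
  · exact Or.inl (hsucc.trans h)

/-- The per-step error is at most a fraction `κ` of the stage cost, so `u / (1 - κ)` is an exact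
supersolution. -/
theorem value_greedy_le (hI : I.IsAdmissible cmin) (hcap : cmin ≤ I.cap)
    (hP : I.IsAccurate δ n Phat ρ)
    (hρ : 0 ≤ ρ) (hβ : 0 < β) (hPβ : ∀ s a s', I.P s a s' ≠ 0 → β ≤ (I.P s a s').toReal)
    {j : ℕ} {f : S → A} (hf : I.IsGreedy δ n Phat (I.viIter δ n Phat j) f)
    (he : ‖I.viIter δ n Phat (j + 1) - I.viIter δ n Phat j‖ ≤ e) {κ : ℝ} (hκ1 : κ < 1)
    (hκ : e + ρ * I.cap * I.transient.card ≤ κ * cmin) (s : S) :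
    I.value (detPolicy f) s ≤ (I.viIter δ n Phat j s + ρ * I.cap / β) / (1 - κ) := by
  set v := I.viIter δ n Phat j with hv
  set u := I.raise (ρ * I.cap / β) v with hu
  have hcap0 : 0 ≤ I.cap := hI.cmin_pos.le.trans hcap
  have hρM : 0 ≤ ρ * I.cap := mul_nonneg hρ hcap0
  have hτ : 0 ≤ ρ * I.cap / β := div_nonneg hρM hβ.le
  have hη : 0 ≤ ρ * I.cap * I.transient.card := mul_nonneg hρM (Nat.cast_nonneg _)
  have he0 : 0 ≤ e := (norm_nonneg _).trans he
  have hκ0 : 0 ≤ κ := by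
    by_contra! h
    nlinarith [hI.cmin_pos]
  have h1κ : 0 < 1 - κ := by linarith
  have hv0 : ∀ s, 0 ≤ v s := viIter_nonneg hI hP j
  have hvu : ∀ s, v s ≤ u s := le_raise hτ v
  have hudiv : ∀ s, u s ≤ u s / (1 - κ) := fun s => by
    rw [le_div_iff₀ h1κ]
    nlinarith [(hv0 s).trans (hvu s)]
  have hmain : I.value (detPolicy f) ≤ fun s => u s / (1 - κ) := by
    refine value_le_of_evalOp_le (fun s => ?_) (fun s => ?_)
    · refine le_trans ?_ ((hvu s).trans (hudiv s))
      exact (planOp_mono hP).monotone_iterate_of_le_map (terminal_le_planOp hI hP)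
        (Nat.zero_le j) s
    · rw [evalOp_apply]
      split_ifs with hs
      · rw [← viIter_of_mem_goal (δ := δ) (n := n) (Phat := Phat) hs j]
        exact (hvu s).trans (hudiv s)
      · rcases viIter_succ_eq_cap_or hI hP hρ hβ hPβ hf he hs with h | h
        -- At a capped state `u ≥ cap - e`, and `e ≤ κ * cmin ≤ κ * cap`; this is where `hcap`
        -- enters.
        · refine (min_le_right _ _).trans ?_
          have h1 := viIter_succ_le_add he s
          rw [h] at h1
          rw [le_div_iff₀ h1κ]
          have h2 : κ * cmin ≤ κ * I.cap := mul_le_mul_of_nonneg_left hcap hκ0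
          linarith [hvu s]
        · refine (min_le_left _ _).trans ?_
          have hc := le_stageCost (π := detPolicy f) hI s
          simp_rw [← mul_div_assoc, ← Finset.sum_div]
          rw [← sub_nonneg, ← sub_sub, sub_right_comm, ← sub_div, sub_nonneg, le_div_iff₀ h1κ]
          have h2 : κ * cmin ≤ κ * I.stageCost (detPolicy f) s := mul_le_mul_of_nonneg_left hc hκ0
          linarith
  refine (hmain s).trans ?_
  refine div_le_div_of_nonneg_right ?_ h1κ.le
  rw [hu, raise]
  split_ifs <;> linarith

/-- Comparing `failProb` with the raised iterate directly, instead of through the greedy policy's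
value, avoids the multiplicative loss `1 / (1 - κ)`. -/
theorem cap_mul_failProb_greedy_le [MeasurableSpace S] [MeasurableSingletonClass S]
    (hI : I.IsAdmissible cmin) (hP : I.IsAccurate δ n Phat ρ)
    (hρ : 0 ≤ ρ) (hβ : 0 < β) (hPβ : ∀ s a s', I.P s a s' ≠ 0 → β ≤ (I.P s a s').toReal)
    {j : ℕ} {f : S → A} (hf : I.IsGreedy δ n Phat (I.viIter δ n Phat j) f)
    (he : ‖I.viIter δ n Phat (j + 1) - I.viIter δ n Phat j‖ ≤ e) (h2e : 2 * e ≤ cmin)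
    (hη : e + ρ * I.cap * I.transient.card < cmin) (π : S → PMF A) (s : S) :
    I.cap * I.failProb (detPolicy f) s ≤
      I.value π s + (ρ * I.cap / β + ρ * I.cap * I.transient.card) := by
  set v := I.viIter δ n Phat j with hv
  set u := I.raise (ρ * I.cap / β) v with hu
  have hcap0 : 0 ≤ I.cap := (hI.terminal_nonneg s).trans (hI.terminal_le s)
  have hρM : 0 ≤ ρ * I.cap := mul_nonneg hρ hcap0
  have hτ : 0 ≤ ρ * I.cap / β := div_nonneg hρM hβ.le
  have hη0 : 0 ≤ ρ * I.cap * I.transient.card := mul_nonneg hρM (Nat.cast_nonneg _)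
  have he0 : 0 ≤ e := (norm_nonneg _).trans he
  have hv0 : ∀ s, 0 ≤ v s := viIter_nonneg hI hP j
  have hvu : ∀ s, v s ≤ u s := le_raise hτ v
  have hch : ∀ s, I.cap * I.failProb (detPolicy f) s ≤ I.cap := fun s =>
    mul_le_of_le_one_right hcap0 (failProb_le_one s)
  set g : S → ℝ := fun s => I.cap * I.failProb (detPolicy f) s - u s with hg
  have hstep : ∀ s ∉ I.goal, I.viIter δ n Phat (j + 1) s = I.cap ∨
      g s ≤ ∑ s', I.trans (detPolicy f) s s' * g s' +
        (e + ρ * I.cap * I.transient.card - cmin) := by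
    intro s hs
    refine (viIter_succ_eq_cap_or hI hP hρ hβ hPβ hf he hs).imp_right fun h => ?_
    have hc := le_stageCost (π := detPolicy f) hI s
    have h1 : ∑ s', I.trans (detPolicy f) s s' * g s' = I.cap * I.failProb (detPolicy f) s -
        ∑ s', I.trans (detPolicy f) s s' * u s' := by
      rw [failProb_of_notMem_goal hs, Finset.mul_sum, ← Finset.sum_sub_distrib]
      exact Finset.sum_congr rfl fun s' _ => by simp only [hg]; ring
    rw [h1]
    simp only [hg]
    linarith
  have hge : ∀ s, g s ≤ e := by
    refine le_of_lt_sum_trans (I := I) (π := detPolicy f) fun s => ?_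
    by_cases hs : s ∈ I.goal
    · left
      simp only [hg]
      rw [failProb_of_mem_goal hs]
      linarith [hv0 s, hvu s]
    rcases hstep s hs with h | h
    · left
      have h1 := viIter_succ_le_add he s
      simp only [hg]
      linarith [hvu s, hch s]
    · right
      linarith
  by_cases hs : s ∈ I.goal
  · rw [failProb_of_mem_goal hs]
    linarith [value_nonneg (π := π) hI s]
  rcases hstep s hs with h | h
  · linarith [viIter_le_value hI hP π (j + 1) s, hch s]
  -- One more Bellman step turns `g ≤ e` into `g ≤ 2e + ρ * cap * |T| - cmin`, and `2e ≤ cmin`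
  -- removes the stopping residual.
  · have h1 := sum_trans_mul_mono (I := I) (π := detPolicy f) (x := g) (y := fun _ => e) hge s
    rw [sum_trans_mul_const] at h1
    have h2 : u s = v s + ρ * I.cap / β := by rw [hu, raise, if_neg hs]
    have h3 : g s = I.cap * I.failProb (detPolicy f) s - u s := rfl
    linarith [viIter_le_value hI hP π j s]

end TransientProblem

/-! ### From sample size to accuracy -/

/-- Inverts `n ≳ R log n`: with `t = n / R`, the logarithm of `2 * n * B` splits into those of `2 *
R * B`, `t / (8C)` and `8C`. The first is at most `2l` and the others are bounded by `log x ≤ x -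
1`; since `l ≥ 1/2`, the term `16C * l` absorbs `8C`. -/
theorem two_le_and_log_div_le {C R B n : ℝ} (hC : 1 ≤ C) (hR : 1 / 4 ≤ R) (hB : 1 ≤ B)
    (hn : 8 * C * (2 + 16 * C) * R * Real.log (2 + R * B) ≤ n) :
    2 ≤ n ∧ Real.log (4 * n ^ 2 * B ^ 2) / (n - 1) ≤ 1 / (C * R) := by
  have hR0 : 0 < R := by linarith
  have hB0 : 0 < B := by linarith
  have hC0 : 0 < C := by linarith
  have hRB : 0 < R * B := mul_pos hR0 hB0
  have hsq : ∀ x : ℝ, 2 * Real.log x = Real.log (x ^ 2) := fun x => by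
    rw [Real.log_pow, Nat.cast_two]
  have hl : 1 / 2 ≤ Real.log (2 + R * B) :=
    (by linarith [Real.log_two_gt_d9] : (1 : ℝ) / 2 ≤ Real.log 2).trans
      (Real.log_le_log two_pos (by linarith))
  set l := Real.log (2 + R * B) with hl_def
  set t := n / R with ht
  have hnt : n = R * t := by rw [ht, mul_div_cancel₀ _ hR0.ne']
  have htl : 8 * C * (2 + 16 * C) * l ≤ t := by
    rw [ht, le_div_iff₀ hR0]
    linarith
  have htl' : (2 + 16 * C) * l ≤ t / (8 * C) := by
    rw [le_div_iff₀ (by positivity)]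
    linarith
  have ht72 : 72 ≤ t := by nlinarith [mul_nonneg (sub_nonneg.2 hC) (sub_nonneg.2 hC)]
  have ht0 : 0 < t := by linarith
  have hn2 : 2 ≤ n := by rw [hnt]; nlinarith
  have hn0 : 0 < n := by linarith
  refine ⟨hn2, ?_⟩
  have h1 : Real.log (2 * n * B) ≤ t / (4 * C) := by
    have e : 2 * n * B = 2 * (R * B) * (t / (8 * C) * (8 * C)) := by
      rw [div_mul_cancel₀ _ (by positivity), hnt]
      ring
    have h2 : Real.log (2 * (R * B)) ≤ 2 * l := by
      rw [hl_def, hsq]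
      exact Real.log_le_log (by positivity) (by nlinarith)
    have h3 := Real.log_le_sub_one_of_pos (show 0 < t / (8 * C) by positivity)
    have h4 := Real.log_le_sub_one_of_pos (show 0 < 8 * C by positivity)
    have h5 : t / (4 * C) = t / (8 * C) + t / (8 * C) := by
      field_simp
      norm_num
    rw [e, Real.log_mul (x := 2 * (R * B)) (by positivity) (by positivity),
      Real.log_mul (x := t / (8 * C)) (by positivity) (by positivity), h5]
    nlinarith
  have h2 : Real.log (4 * n ^ 2 * B ^ 2) = 2 * Real.log (2 * n * B) := by
    rw [hsq]
    congr 1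
    ring
  rw [h2, div_le_div_iff₀ (by linarith) (by positivity)]
  have h3 : t / (4 * C) * (C * R) = n / 4 := by
    rw [hnt]
    field_simp
  have h4 := mul_le_mul_of_nonneg_right h1 (show 0 ≤ C * R by positivity)
  linarith

namespace TransientProblem

variable {S : Type u} {A : Type v} [Fintype S] [DecidableEq S] [Fintype A]

theorem waitTime_eq {β : ℝ} (hβ : 0 < β) (hβ1 : β < 1) (N : ℕ) :
    1 / β ^ N * ((1 - β ^ N) / (1 - β)) = waitTime β N := by
  have h1 : 1 - β ≠ 0 := by linarith
  induction N with
  | zero => simp [waitTime]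
  | succ N ih =>
    rw [waitTime, Finset.sum_range_succ, ← waitTime, ← ih, inv_pow]
    field_simp
    ring

theorem terminal_of_mem_comp {I : TransientProblem S A}
    (hdisj : ∀ i j, i ≠ j → Disjoint (I.comp i) (I.comp j)) {i : Fin I.k} {s : S}
    (hs : s ∈ I.comp i) : I.terminal s = I.lam * I.gain i := by
  rw [terminal, Finset.sum_eq_single i, if_pos hs]
  · exact fun j _ hj => if_neg fun hsj => Finset.disjoint_left.1 (hdisj j i hj) hsj hs
  · exact fun h => absurd (Finset.mem_univ i) h

theorem terminal_mem_Icc {I : TransientProblem S A} {cmax : ℝ} (hcmax : 0 ≤ cmax)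
    (hdisj : ∀ i j, i ≠ j → Disjoint (I.comp i) (I.comp j))
    (hgain : ∀ i, 0 ≤ I.gain i ∧ I.gain i ≤ cmax) (hlam : 0 ≤ I.lam) (s : S) :
    I.terminal s ∈ Set.Icc 0 (I.lam * cmax) := by
  by_cases hs : s ∈ I.goal
  · obtain ⟨i, -, hi⟩ := Finset.mem_biUnion.1 hs
    rw [terminal_of_mem_comp hdisj hi]
    exact ⟨mul_nonneg hlam (hgain i).1, mul_le_mul_of_nonneg_left (hgain i).2 hlam⟩
  · rw [terminal_of_notMem_goal hs]
    exact ⟨le_rfl, mul_nonneg hlam hcmax⟩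

variable [Nonempty S] [Nonempty A] {I : TransientProblem S A} {δ : ℝ} {n : ℕ}

theorem xi_le_of_sampleBound_le {C cmin epsPT : ℝ} (hC : 1 ≤ C) (hδ : 0 < δ) (hδ1 : δ < 1)
    (hR : 1 / 4 ≤ I.rate cmin epsPT)
    (hn : I.sampleBound (8 * C * (2 + 16 * C)) 1 δ cmin epsPT ≤ n) :
    1 < n ∧ xi S A δ n ≤ 1 / (C * I.rate cmin epsPT) := by
  have h2 : (1 : ℝ) ≤ Fintype.card S := Nat.one_le_cast.2 Fintype.card_pos
  have h3 : (1 : ℝ) ≤ Fintype.card A := Nat.one_le_cast.2 Fintype.card_pos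
  have hSA := one_le_mul_of_one_le_of_one_le h2 h3
  have hB : 1 ≤ (Fintype.card S : ℝ) * Fintype.card A / δ := (one_le_div hδ).2 (by linarith)
  rw [sampleBound, pow_one, mul_assoc (I.rate cmin epsPT), mul_div_assoc] at hn
  obtain ⟨hn2, h⟩ := two_le_and_log_div_le hC hR hB hn
  have hn1 : 1 < n := by exact_mod_cast (by linarith : (1 : ℝ) < n)
  refine ⟨hn1, le_trans ?_ h⟩
  refine div_le_div_of_nonneg_right (Real.log_le_log
    (zero_lt_one.trans_le (one_le_xi_arg hδ hδ1 hn1.le)) ?_) (by linarith)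
  have h4 : (Fintype.card S : ℝ) ^ 2 * Fintype.card A / δ ≤
      ((Fintype.card S : ℝ) * Fintype.card A / δ) ^ 2 := by
    rw [div_pow, mul_pow, div_le_div_iff₀ hδ (by positivity)]
    have h5 : (Fintype.card A : ℝ) * δ ≤ (Fintype.card A : ℝ) ^ 2 := by nlinarith
    calc (Fintype.card S : ℝ) ^ 2 * Fintype.card A * δ ^ 2 =
          (Fintype.card S : ℝ) ^ 2 * (Fintype.card A * δ) * δ := by ring
      _ ≤ _ := by gcongr
  calc 4 * (n : ℝ) ^ 2 * (Fintype.card S : ℝ) ^ 2 * (Fintype.card A : ℝ) / δ =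
        4 * (n : ℝ) ^ 2 * ((Fintype.card S : ℝ) ^ 2 * Fintype.card A / δ) := by ring
    _ ≤ _ := by gcongr

theorem radius_le {q : ℝ} (h0 : 0 ≤ xi S A δ n) (h1 : xi S A δ n ≤ 1) :
    radius S A δ n q ≤ 4 * Real.sqrt (xi S A δ n) := by
  have h2 : Real.sqrt (2 * q * (1 - q) * xi S A δ n) ≤ Real.sqrt (xi S A δ n) :=
    Real.sqrt_le_sqrt (mul_le_of_le_one_left h0 (by nlinarith [sq_nonneg (2 * q - 1)]))
  have h3 : xi S A δ n ≤ Real.sqrt (xi S A δ n) := by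
    refine Real.le_sqrt_of_sq_le ?_
    nlinarith
  rw [radius]
  linarith

/-- At an empirical frequency `0` or `1` the variance term vanishes, leaving a radius below `β`. A
true transition, having probability at least `β`, then cannot be missed, so the support constraints
hold for `P`. The factor `8` is two radii of `4 √ξ`, by the triangle inequality. -/
theorem isAccurate_of_mem_goodEvent {Ω : Type w} {X : S → A → ℕ → Ω → S} {ω : Ω} {β : ℝ}
    (hω : ω ∈ I.goodEvent X δ) (hn : 1 < n) (h0 : 0 ≤ xi S A δ n) (h1 : xi S A δ n ≤ 1)
    (hβ : 7 / 3 * xi S A δ n < β) (hPβ : ∀ s a s', I.P s a s' ≠ 0 → β ≤ (I.P s a s').toReal) :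
    I.IsAccurate δ n (empirical X n ω) (8 * Real.sqrt (xi S A δ n)) where
  mem_plausible s a := by
    refine ⟨⟨fun s' => ENNReal.toReal_nonneg, PMF.sum_toReal_eq_one _⟩, fun s' => ?_⟩
    have h := hω s a s' n hn
    split_ifs with hq
    · rcases hq with hq | hq
      · rw [hq] at h ⊢
        by_contra hne
        have h2 := hPβ s a s' fun hP => hne (by simp [hP])
        have h3 : radius S A δ n 0 = 7 / 3 * xi S A δ n := by simp [radius]
        rw [h3, sub_zero, abs_of_nonneg ENNReal.toReal_nonneg] at h
        linarith
      · rw [hq] at h ⊢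
        have h3 : radius S A δ n 1 = 7 / 3 * xi S A δ n := by simp [radius]
        have hsum := PMF.sum_toReal_eq_one (I.P s a)
        rw [← Finset.add_sum_erase _ _ (Finset.mem_univ s')] at hsum
        by_cases hz : ∀ t ∈ Finset.univ.erase s', (I.P s a t).toReal = 0
        · rwa [Finset.sum_eq_zero hz, add_zero] at hsum
        · push Not at hz
          obtain ⟨t, ht, htz⟩ := hz
          have h4 := Finset.single_le_sum (f := fun t => (I.P s a t).toReal)
            (fun t _ => ENNReal.toReal_nonneg) ht
          have h5 := hPβ s a t fun hP => htz (by simp [hP])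
          rw [h3] at h
          linarith [neg_le_of_abs_le h]
    · exact h
  sub_le s a p hp s' := by
    have h2 := (hω s a s' n hn).trans (radius_le h0 h1)
    have h3 : |p s' - empirical X n ω s a s'| ≤ 4 * Real.sqrt (xi S A δ n) := by
      have h4 := hp.2 s'
      split_ifs at h4
      · rw [h4, sub_self, abs_zero]
        positivity
      · exact h4.trans (radius_le h0 h1)
    linarith [le_of_abs_le h2, neg_le_of_abs_le h3]

theorem reachProb_of_goal_eq_empty [MeasurableSpace S] [MeasurableSingletonClass S]
    (h : I.goal = ∅) (π : S → PMF A) (s : S) : I.reachProb π s = 0 := by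
  simp [reachProb, h]

/-- The guarantees for a planner's output in terms of the accuracy of the confidence sets. -/
theorem output_guarantee [MeasurableSpace S] [MeasurableSingletonClass S]
    {cmin cmax β epsPT ρ : ℝ} {Phat : S → A → S → ℝ}
    (hI : I.IsAdmissible cmin) (hcost : ∀ s a, I.cost s a ≤ cmax)
    (hterm : ∀ s, I.terminal s ≤ I.lam * cmax) (hβ : 0 < β) (hβ1 : β < 1)
    (hPβ : ∀ s a s', I.P s a s' ≠ 0 → β ≤ (I.P s a s').toReal)
    (hφ : 0 < I.epsPhi) (hφ1 : I.epsPhi ≤ 1)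
    (hV : (waitTime β (Fintype.card S) + I.lam) * cmax ≤ I.Vbar) (hVβ : cmin / β ≤ I.Vbar)
    (hPT : 0 < epsPT) (he : cmin * epsPT * I.epsPhi / (4 * I.Vbar) ≤ cmin / 2)
    (hP : I.IsAccurate δ n Phat ρ) (hρ : 0 ≤ ρ) (hT : 1 ≤ I.transient.card)
    (hη : ρ * I.cap * I.transient.card ≤ cmin * epsPT * I.epsPhi / (4 * I.Vbar) / 16)
    {f : S → A} (hf : I.IsPlanOutput δ cmin epsPT n Phat f) :
    (∀ π', I.IsCostOptimal π' → ‖I.value (detPolicy f) - I.value π'‖ < epsPT) ∧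
    (∀ π', I.IsReachOptimal π' → ∀ s,
      |I.reachProb (detPolicy f) s - I.reachProb π' s| ≤ I.epsPhi) := by
  obtain ⟨j, hj, hgreedy⟩ := hf
  have hc := hI.cmin_pos
  have hV0 : 0 < I.Vbar := (div_pos hc hβ).trans_le hVβ
  set e := cmin * epsPT * I.epsPhi / (4 * I.Vbar) with he_def
  have he0 : 0 < e := by positivity
  have hcapV : I.Vbar ≤ I.cap := le_div_self hV0.le hφ hφ1
  have hcβ : cmin ≤ cmin / β := le_div_self hc.le hβ hβ1.le
  have hcap0 : 0 < I.cap := hV0.trans_le hcapV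
  have hT' : (1 : ℝ) ≤ I.transient.card := Nat.one_le_cast.2 hT
  have hρM : 0 ≤ ρ * I.cap := mul_nonneg hρ hcap0.le
  have hρM' : ρ * I.cap ≤ e / 16 := (le_mul_of_one_le_right hρM hT').trans hη
  have hτ : ρ * I.cap / β ≤ e / 16 / β := div_le_div_of_nonneg_right hρM' hβ.le
  have hβinv : 1 ≤ 1 / β := (one_le_div hβ).2 hβ1.le
  constructor
  · intro π' hπ'
    rw [pi_norm_lt_iff hPT]
    intro s
    rw [Pi.sub_apply, Real.norm_of_nonneg (sub_nonneg.2 (hπ' (detPolicy f) s))]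
    -- The numerator is the residual `e` plus the transient error, at most `e / 16`.
    have hκ : 17 / 16 * e / cmin ≤ 17 / 32 := by
      rw [div_le_iff₀ hc]
      linarith
    have h1 := value_greedy_le hI (hcβ.trans (hVβ.trans hcapV)) hP hρ hβ hPβ hgreedy hj
      (κ := 17 / 16 * e / cmin) (by linarith)
      (by rw [div_mul_cancel₀ _ hc.ne']; linarith) s
    have hv := viIter_le_value hI hP π' j s
    have hvc := viIter_le_cap hI hP j s
    have hv0 := viIter_nonneg hI hP j s
    set x := I.viIter δ n Phat j s
    set κ := 17 / 16 * e / cmin with hκ_def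
    have hκM : κ * I.cap = 17 / 64 * epsPT := by
      rw [hκ_def, he_def, cap]
      field_simp
      norm_num
    have hτ' : e / 16 / β ≤ epsPT / 64 := by
      have h2 : e / 16 / β = (cmin / β) * (epsPT / 64) * (I.epsPhi / I.Vbar) := by
        rw [he_def]
        field_simp
        norm_num
      have h3 : (cmin / β) * (I.epsPhi / I.Vbar) ≤ 1 := by
        rw [mul_div_assoc', div_le_one hV0]
        exact (mul_le_of_le_one_right (by positivity) hφ1).trans hVβ
      rw [h2, mul_right_comm]
      exact mul_le_of_le_one_left (by positivity) h3
    -- In units of `epsPT / 64`, the losses `κ * x`, `κ * epsPT` and the raise are at most `17`,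
    -- `34` and `1`, totalling `52 < 64`.
    have h4 : (x + ρ * I.cap / β) / (1 - κ) < x + epsPT := by
      rw [div_lt_iff₀ (by linarith)]
      have h5 : κ * x ≤ κ * I.cap := mul_le_mul_of_nonneg_left hvc (by positivity)
      nlinarith
    linarith
  · intro π' hπ' s
    rw [abs_sub_comm, abs_of_nonneg (sub_nonneg.2 (hπ' (detPolicy f) s))]
    rcases I.goal.eq_empty_or_nonempty with hG | hG
    · rw [reachProb_of_goal_eq_empty hG, reachProb_of_goal_eq_empty hG, sub_zero]
      exact hφ.le
    -- `β` bounds the transition probabilities of deterministic policies only, so the given `π'` is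
    -- compared through a deterministic reach-optimal policy.
    obtain ⟨f', hf'⟩ := I.exists_isReachOptimal
    have h1 := cap_mul_failProb_greedy_le hI hP hρ hβ hPβ hgreedy hj (by linarith) (by linarith)
      (detPolicy f') s
    have h2 := value_le_cap_mul_failProb_add (π := detPolicy f') hI hβ (fun s s' h => by
      rw [trans_detPolicy] at h ⊢
      exact hPβ _ _ _ fun h0 => h (by rw [h0, ENNReal.toReal_zero])) hcost hterm s
    have h3 : I.cap * I.failProb (detPolicy f') s ≤ I.cap * I.failProb π' s :=
      mul_le_mul_of_nonneg_left (sub_le_sub_left (hf' π' s) 1) hcap0.le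
    have hcmax : cmin ≤ cmax := by
      obtain ⟨a⟩ := ‹Nonempty A›
      exact (hI.cmin_le s a).trans (hcost s a)
    have hcard : I.transient.card + 1 ≤ Fintype.card S := by
      rw [transient, Finset.card_sdiff_of_subset (Finset.subset_univ _), Finset.card_univ]
      have := Finset.card_pos.2 hG
      have := Finset.card_le_univ I.goal
      omega
    -- As the goal is nonempty, `|T| < |S|`; the extra summand of the waiting time in `Vbar` leaves
    -- room `cmax / β` for the statistical errors.
    have hw : waitTime β I.transient.card + 1 / β ≤ waitTime β (Fintype.card S) := by
      refine le_trans ?_ (waitTime_mono hβ hcard)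
      rw [waitTime, waitTime, Finset.sum_range_succ, one_div]
      exact add_le_add le_rfl (le_self_pow₀ (by rwa [← one_div]) (Nat.succ_ne_zero _))
    have hslack : ρ * I.cap / β + ρ * I.cap * I.transient.card ≤ 1 / β * cmax := by
      have h4 : e / 16 / β = 1 / β * (e / 16) := by ring
      have h5 : e / 16 ≤ 1 / β * (e / 16) := le_mul_of_one_le_left (by positivity) hβinv
      have h6 : 1 / β * (e / 16 + e / 16) ≤ 1 / β * cmax :=
        mul_le_mul_of_nonneg_left (by linarith) (by positivity)
      linarith
    have h7 := mul_le_mul_of_nonneg_right hw (hc.le.trans hcmax)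
    have h8 : I.cap * (I.failProb (detPolicy f) s - I.failProb π' s) ≤ I.Vbar := by
      rw [mul_sub]
      linarith
    have h9 : I.failProb (detPolicy f) s - I.failProb π' s ≤ I.Vbar / I.cap := by
      rw [le_div_iff₀ hcap0]
      linarith
    have h10 : I.Vbar / I.cap = I.epsPhi := by
      rw [cap]
      field_simp
    simp only [failProb] at h9
    linarith

/-- Without transient states the planner has nothing to decide. -/
theorem output_guarantee_of_transient_eq_empty [MeasurableSpace S] [MeasurableSingletonClass S]
    {cmin : ℝ} (hI : I.IsAdmissible cmin) (hT : I.transient = ∅) (π π' : S → PMF A) :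
    I.value π = I.value π' ∧ ∀ s, I.reachProb π s = I.reachProb π' s := by
  have hG : ∀ s, s ∈ I.goal := fun s => by
    by_contra hs
    exact Finset.notMem_empty s (hT ▸ mem_transient.2 hs)
  have hval : ∀ π, I.value π = I.terminal := fun π => by
    rw [← evalOp_value hI]
    funext s
    rw [evalOp_apply, if_pos (hG s)]
  exact ⟨(hval π).trans (hval π').symm, fun s => by
    rw [reachProb_of_mem_goal (hG s), reachProb_of_mem_goal (hG s)]⟩

end TransientProblem

end

/-! ### The proposition -/

open TransientProblem in
theorem mainTheorem3 :
    ∃ (K : ℝ) (q : ℕ), 0 < K ∧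
      ∀ (S : Type u) (A : Type v) (Ω : Type w)
        [Fintype S] [DecidableEq S] [Nonempty S] [MeasurableSpace S] [MeasurableSingletonClass S]
        [Fintype A] [Nonempty A] [MeasurableSpace Ω]
        (μ : Measure Ω) [IsProbabilityMeasure μ]
        (I : TransientProblem S A) (X : S → A → ℕ → Ω → S)
        (cmin cmax β δ epsPT : ℝ),
        0 < cmin →
        (∀ s a, cmin ≤ I.cost s a ∧ I.cost s a ≤ cmax) →
        0 < β → β < 1 →
        (∀ s a s', I.P s a s' ≠ 0 → β ≤ (I.P s a s').toReal) →
        (∀ i j, i ≠ j → Disjoint (I.comp i) (I.comp j)) →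
        (∀ i, 0 ≤ I.gain i ∧ I.gain i ≤ cmax) →
        0 ≤ I.lam →
        0 < I.epsPhi → I.epsPhi ≤ 1 →
        (1 / β ^ Fintype.card S * ((1 - β ^ Fintype.card S) / (1 - β)) + I.lam) * cmax ≤ I.Vbar →
        0 < epsPT →
        cmin * epsPT * I.epsPhi / (4 * I.Vbar) ≤ cmin / 2 →
        0 < δ → δ < 1 →
        (∀ s a j, Measurable (X s a j)) →
        (∀ s a j, μ.map (X s a j) = (I.P s a).toMeasure) →
        (∀ s a, iIndepFun (fun j => X s a j) μ) →
        (∃ π, I.IsCostOptimal π) ∧ (∃ π, I.IsReachOptimal π) ∧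
        1 - δ ≤ μ.real (I.goodEvent X δ) ∧
        ∀ ω ∈ I.goodEvent X δ, ∀ n : ℕ, I.sampleBound K q δ cmin epsPT ≤ n →
          (∃ x, Tendsto (I.viIter δ n (TransientProblem.empirical X n ω)) atTop (𝓝 x)) ∧
          (∃ f, I.IsPlanOutput δ cmin epsPT n (TransientProblem.empirical X n ω) f) ∧
          ∀ f, I.IsPlanOutput δ cmin epsPT n (TransientProblem.empirical X n ω) f →
            (∀ π', I.IsCostOptimal π' →
              ‖I.value (TransientProblem.detPolicy f) - I.value π'‖ < epsPT) ∧
            (∀ π', I.IsReachOptimal π' → ∀ s,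
              |I.reachProb (TransientProblem.detPolicy f) s - I.reachProb π' s| ≤ I.epsPhi) := by
  -- This is `8 * C * (2 + 16 * C)` with `C = 512 ^ 2`, so that `√ξ ≤ 1 / (512 * r)` with `r ^ 2`
  -- the rate; a single power of the logarithm suffices.
  refine ⟨8 * 512 ^ 2 * (2 + 16 * 512 ^ 2), 1, by norm_num, ?_⟩
  intro S A Ω _ _ _ _ _ _ _ _ μ _ I X cmin cmax β δ epsPT hc hcost hβ hβ1 hPβ hdisj hgain hlam
    hφ hφ1 hV hPT he hδ hδ1 hX hlaw hind
  rw [waitTime_eq hβ hβ1] at hV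
  have hcmax : cmin ≤ cmax := by
    obtain ⟨s⟩ := ‹Nonempty S›
    obtain ⟨a⟩ := ‹Nonempty A›
    exact (hcost s a).1.trans (hcost s a).2
  have hcmax0 : 0 < cmax := hc.trans_le hcmax
  have hw : 1 / β ≤ waitTime β (Fintype.card S) := by
    refine le_trans ?_ (waitTime_mono hβ (Fintype.card_pos (α := S)))
    simp [waitTime]
  have hlc := mul_nonneg hlam hcmax0.le
  have hVβ : cmin / β ≤ I.Vbar := by
    have h1 : 1 / β * cmin ≤ waitTime β (Fintype.card S) * cmax :=
      mul_le_mul hw hcmax hc.le (waitTime_nonneg hβ _)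
    rw [div_eq_mul_one_div, mul_comm]
    linarith
  have hV0 : 0 < I.Vbar := (div_pos hc hβ).trans_le hVβ
  have hcapV : I.Vbar ≤ I.cap := le_div_self hV0.le hφ hφ1
  have hterm := terminal_mem_Icc hcmax0.le hdisj hgain hlam
  have hlV : I.lam * cmax ≤ I.Vbar := by
    have := mul_nonneg (waitTime_nonneg hβ (Fintype.card S)) hcmax0.le
    linarith
  have hI : I.IsAdmissible cmin := ⟨hc, fun s a => (hcost s a).1, fun s => (hterm s).1,
    fun s => (hterm s).2.trans (hlV.trans hcapV)⟩
  obtain ⟨f₁, hf₁⟩ := exists_isCostOptimal hI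
  obtain ⟨f₂, hf₂⟩ := I.exists_isReachOptimal
  refine ⟨⟨_, hf₁⟩, ⟨_, hf₂⟩, one_sub_le_measureReal_goodEvent hδ hδ1 hX hlaw hind, ?_⟩
  intro ω hω n hn
  have he0 : 0 < cmin * epsPT * I.epsPhi / (4 * I.Vbar) := by positivity
  -- Without transient states the rate is `0` and the sample bound says nothing about `n`, so this
  -- case is separate.
  rcases I.transient.eq_empty_or_nonempty with hT | hT
  · have hlim : Tendsto (I.viIter δ n (empirical X n ω)) atTop (𝓝 I.terminal) := by
      refine tendsto_const_nhds.congr fun j => funext fun s => (viIter_of_mem_goal ?_ j).symm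
      by_contra hs
      exact Finset.notMem_empty s (hT ▸ mem_transient.2 hs)
    refine ⟨⟨_, hlim⟩, exists_isPlanOutput hlim he0, fun f _ => ⟨fun π' _ => ?_, fun π' _ s => ?_⟩⟩
    · rwa [(output_guarantee_of_transient_eq_empty hI hT (detPolicy f) π').1, sub_self, norm_zero]
    · rw [(output_guarantee_of_transient_eq_empty hI hT (detPolicy f) π').2, sub_self, abs_zero]
      exact hφ.le
  have hT1 : 1 ≤ I.transient.card := Finset.card_pos.2 hT
  have hT' : (1 : ℝ) ≤ I.transient.card := Nat.one_le_cast.2 hT1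
  set r := I.transient.card * I.Vbar ^ 2 / (cmin * epsPT * I.epsPhi ^ 2) with hr
  have hr0 : 0 < r := by positivity
  have hrate : I.rate cmin epsPT = r ^ 2 := by
    rw [rate, hr]
    ring
  -- From `epsPT * epsPhi ≤ 2 * Vbar`, a form of `he`, and `cmin ≤ β * Vbar`. It makes the sample
  -- bound force `ξ` far below `β`, though `β` does not occur in the rate.
  have hrβ : 1 / (2 * β) ≤ r := by
    have h1 : epsPT * I.epsPhi ≤ 2 * I.Vbar := by
      rw [div_le_div_iff₀ (by positivity) two_pos] at he
      nlinarith
    have h2 : cmin * epsPT * I.epsPhi ^ 2 ≤ cmin * (2 * I.Vbar) := by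
      calc cmin * epsPT * I.epsPhi ^ 2 = cmin * (epsPT * I.epsPhi) * I.epsPhi := by ring
        _ ≤ cmin * (epsPT * I.epsPhi) * 1 := by gcongr
        _ ≤ cmin * (2 * I.Vbar) := by rw [mul_one]; gcongr
    rw [hr, div_le_div_iff₀ (by positivity) (by positivity), one_mul]
    have h3 : cmin ≤ β * I.Vbar := by
      rw [div_le_iff₀ hβ] at hVβ
      linarith
    calc _ ≤ cmin * (2 * I.Vbar) := h2
      _ ≤ β * I.Vbar * (2 * I.Vbar) := by gcongr
      _ = 1 * I.Vbar ^ 2 * (2 * β) := by ring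
      _ ≤ _ := by gcongr
  have hr1 : 1 / 2 ≤ r := le_trans (by gcongr; linarith) hrβ
  have hR : 1 / 4 ≤ I.rate cmin epsPT := by
    rw [hrate]
    nlinarith
  obtain ⟨hn1, hxi⟩ := xi_le_of_sampleBound_le (by norm_num) hδ hδ1 hR hn
  have hxi0 := xi_nonneg (S := S) (A := A) hδ hδ1 hn1.le
  have hxir : xi S A δ n ≤ (1 / (512 * r)) ^ 2 := by
    rwa [div_pow, one_pow, mul_pow, ← hrate]
  have hrinv : 1 / (512 * r) ≤ β / 256 := by
    rw [div_le_div_iff₀ (by positivity) (by norm_num)]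
    rw [div_le_iff₀ (by positivity)] at hrβ
    linarith
  have hxiβ : xi S A δ n ≤ (β / 256) ^ 2 :=
    hxir.trans (pow_le_pow_left₀ (by positivity) hrinv 2)
  have hP := isAccurate_of_mem_goodEvent hω hn1 hxi0 (by nlinarith) (by nlinarith) hPβ
  have hlim := tendsto_viIter hI hP
  refine ⟨hlim, exists_isPlanOutput hlim.choose_spec he0, fun f hf => ?_⟩
  refine output_guarantee hI (fun s a => (hcost s a).2) (fun s => (hterm s).2) hβ hβ1 hPβ hφ hφ1 hV
    hVβ hPT he hP (by positivity) hT1 ?_ hf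
  have hsqrt : Real.sqrt (xi S A δ n) ≤ 1 / (512 * r) := Real.sqrt_le_iff.2 ⟨by positivity, hxir⟩
  -- The choice `512 = 8 * 4 * 16` turns this into exactly one sixteenth of the stopping accuracy.
  calc 8 * Real.sqrt (xi S A δ n) * I.cap * I.transient.card
      ≤ 8 * (1 / (512 * r)) * I.cap * I.transient.card := by
        have : 0 ≤ I.cap := hV0.le.trans hcapV
        gcongr
    _ = _ := by
        rw [hr, cap]
        field_simp
        norm_num
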